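/- Let $\xi$ be a nonnegative integer-valued random variable with $p_i=\mathbf P\{\xi=i\}$, mean $\mathbf E\{\xi\}=1$ and variance $0<\mathbf V\{\xi\}<\infty$, and suppose that $p_1>0$. Let $T$ be the Bienaymé–Galton–Watson tree with offspring distribution $\xi$, that is, the random rooted tree in which every node has, independently of the others, $i$ children with probability $p_i$. For each $n\ge 1$ the event that $T$ has exactly $n$ nodes has positive probability; let $T_n$ denote the tree $T$ conditioned on this event. For a node $u$ of a finite rooted tree, the leaf-height $\lambda(u)$ is the length of the shortest path from $u$ to a leaf (a node without children) in the subtree rooted at $u$, so that $\lambda(u)=0$ if $u$ is a leaf. Let $L_n$ be the maximum of $\lambda(u)$ over all nodes $u$ of $T_n$. Then $$\frac{L_n}{\log n}\longrightarrow \frac{1}{\log(1/p_1)}\qquad\text{in probability as } n\to\infty,$$ that is, for every $\varepsilon>0$, $\mathbf P\left\{\left|\frac{L_n}{\log n}-\frac{1}{\log(1/p_1)}\right|\ge\varepsilon\right\}\to 0$ as $n\to\infty$. -/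

import Mathlib

open MeasureTheory ProbabilityTheory Filter Topology

namespace GaltonWatson

/-- The rooted ordered tree coded by a function `k` that gives every word its number of children
(Ulam–Harris coding): nodes are words of natural numbers, the root is `[]`, and the children of a
node `v` are `v ++ [0], …, v ++ [k v - 1]`. A word is a node iff each step along it leads to an
actual child. -/
def nodes (k : List ℕ → ℕ) : Set (List ℕ) :=
  {u | ∀ (v : List ℕ) (i : ℕ), (v ++ [i]) <+: u → i < k v}

/-- The leaves: nodes without children. -/
def leaves (k : List ℕ → ℕ) : Set (List ℕ) :=
  {u | u ∈ nodes k ∧ k u = 0}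

/-- The leaf-height of a node `u`: the smallest length of a path from `u` down to a leaf of the
subtree rooted at `u` (the descendants of `u` at distance `m` are the nodes `u ++ w` with
`w.length = m`). In a finite tree there is always such a leaf. -/
noncomputable def leafHeight (k : List ℕ → ℕ) (u : List ℕ) : ℕ :=
  sInf {m | ∃ w : List ℕ, w.length = m ∧ u ++ w ∈ leaves k}

/-- The leaf-height of the tree: the maximum of the leaf-heights of its nodes (a maximum over a
finite nonempty set when the tree is finite). -/
noncomputable def maxLeafHeight (k : List ℕ → ℕ) : ℕ :=
  sSup (leafHeight k '' nodes k)

/-- The total number of nodes of the tree, possibly infinite. -/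
noncomputable def size (k : List ℕ → ℕ) : ℕ∞ :=
  (nodes k).encard

/-- The family of offspring numbers of a Galton–Watson tree with offspring distribution `p`:
independent random variables `ξ u`, one for each potential node `u`, each of law `p`. The
Galton–Watson tree is then the random tree `nodes (fun u => ξ u ω)`. -/
structure IsOffspringFamily {Ω : Type*} [MeasurableSpace Ω] (P : Measure Ω) (p : PMF ℕ)
    (ξ : List ℕ → Ω → ℕ) : Prop where
  measurable : ∀ u, Measurable (ξ u)
  law : ∀ u, P.map (ξ u) = p.toMeasure
  indep : iIndepFun ξ P

end GaltonWatson

namespace GaltonWatson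

open scoped ENNReal

/-! Write b = `p 1`. Listing offspring numbers in preorder identifies finite trees with words whose
walk with steps a - 1 first hits -1 at the very end; the probability of a tree is the product of its
letter probabilities. With S_n a sum of n independent copies of ξ, the cycle lemma gives n P(|T| =
n) = P(S_n = n - 1) (`mul_cardProb_le_sumProb`, `sumProb_le_mul_cardProb`). Local limit estimates
give P(S_n = k) = O(n^(-1/2)) uniformly in k (`exists_sumProb_le`) and P(|T| = n) ≥ c n^(-3/2)
eventually (`exists_le_cardProb`), so conditioning on the size costs only a power of n.

Upper bound. Let a_h be the probability that the tree is finite with root of leaf-height at least h.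
Then a_(h+1) ≤ (b + a_h) a_h, and a_h ≤ (1 - p 0)^h is summable, so a_h ≤ ∏ (b + a_j) = O(b^h)
(`exists_heightBound_le`). If a tree with n nodes has a subtree with m nodes and leaf-height at
least h, rotate its word so that this subtree comes first: the other n - m letters sum to n - m.
Hence the probability of size n with some high node is at most Σ_m P(|T| = m, root high) P(S_(n-m) =
n - m) (`highProb_le_sum`). For m ≤ n/2 the last factor is O(n^(-1/2)); for m > n/2 the first is
O((h + 1) b^h / m) (`mul_heightCardProb_le`). The sum is O((h + 1) b^h n^(-1/2)), and O((h + 1) b^h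
n) after conditioning, which vanishes for h = ⌈(1/log(1/b) + ε) log n⌉.

Lower bound. A run of h ones in the word is a chain of h one-child nodes, whose top has leaf-height
at least h. Independent letters avoid such a run with probability at most (1 - b^h)^⌊n/h⌋. For h
about (1/log(1/b) - ε) log n this beats the factor n^(3/2) lost by conditioning. -/

/-- Finite rooted ordered trees. -/
inductive PlaneTree : Type
  | node (n : ℕ) (f : Fin n → PlaneTree) : PlaneTree

/-! ### Preorder words, subtrees and root leaf-height. -/

namespace PlaneTree

/-- The numbers of children of the nodes, in preorder. -/
def word : PlaneTree → List ℕ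
  | node n f => n :: (List.ofFn fun i => word (f i)).flatten

/-- `s.IsSubtree t`: `s` is the subtree of `t` rooted at one of its nodes. -/
inductive IsSubtree : PlaneTree → PlaneTree → Prop
  | refl (t : PlaneTree) : IsSubtree t t
  | child {s : PlaneTree} {n : ℕ} {f : Fin n → PlaneTree} (i : Fin n)
      (h : IsSubtree s (f i)) : IsSubtree s (node n f)

/-- The leaf-height of the root is at least `h`. -/
def LeafHeightGE : ℕ → PlaneTree → Prop
  | 0, _ => True
  | h + 1, node n f => n ≠ 0 ∧ ∀ i, LeafHeightGE h (f i)

end PlaneTree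

open PlaneTree

/-! ### Forest words as first-passage paths, and their unique parsing. -/

/-- `IsForestWord r l`: `l` is the concatenation of the words of `r` trees. -/
def IsForestWord : ℕ → List ℕ → Prop
  | 0, [] => True
  | 0, _ :: _ => False
  | _ + 1, [] => False
  | r + 1, a :: l => IsForestWord (r + a) l

/-- The drift of a word, the sum of `a - 1` over its letters `a`. -/
def drift (l : List ℕ) : ℤ := (l.sum : ℤ) - l.length

@[simp] lemma drift_nil : drift [] = 0 := rfl

@[simp] lemma drift_cons (a : ℕ) (l : List ℕ) : drift (a :: l) = a - 1 + drift l := by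
  simp [drift]; ring

@[simp] lemma drift_append (x y : List ℕ) : drift (x ++ y) = drift x + drift y := by
  simp [drift]; ring

lemma IsForestWord.drift_eq {r : ℕ} {l : List ℕ} (h : IsForestWord r l) : drift l = -r := by
  induction l generalizing r with
  | nil => cases r <;> simp_all [IsForestWord]
  | cons a l ih =>
    cases r with
    | zero => simp [IsForestWord] at h
    | succ r => have := ih h; simp [this]; ring

lemma IsForestWord.drift_prefix {r : ℕ} {x y : List ℕ} (h : IsForestWord r (x ++ y))
    (hy : y ≠ []) : -(r : ℤ) < drift x := by
  induction x generalizing r with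
  | nil =>
    cases r with
    | zero => cases y <;> simp_all [IsForestWord]
    | succ r => simp; omega
  | cons a l ih =>
    cases r with
    | zero => simp [IsForestWord] at h
    | succ r => have := ih h; simp only [drift_cons]; push_cast at *; linarith

lemma isForestWord_of_drift {r : ℕ} {l : List ℕ} (hl : drift l = -r)
    (h : ∀ x y, l = x ++ y → y ≠ [] → -(r : ℤ) < drift x) : IsForestWord r l := by
  induction l generalizing r with
  | nil => cases r <;> simp_all [IsForestWord]; omega
  | cons a l ih =>
    cases r with
    | zero => have := h [] (a :: l) rfl (by simp); simp at this
    | succ r =>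
      refine ih ?_ fun x y hxy hy => ?_
      · simp at hl; push_cast; linarith
      · have := h (a :: x) y (by simp [hxy]) hy
        simp only [drift_cons] at this; push_cast at *; linarith

lemma IsForestWord.append {r s : ℕ} {x y : List ℕ} (hx : IsForestWord r x)
    (hy : IsForestWord s y) : IsForestWord (r + s) (x ++ y) := by
  induction x generalizing r with
  | nil => cases r <;> simp_all [IsForestWord]
  | cons a l ih =>
    cases r with
    | zero => simp [IsForestWord] at hx
    | succ r =>
      have := ih hx
      rw [show r + 1 + s = (r + s) + 1 by ring]
      simp only [List.cons_append, IsForestWord]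
      rwa [show r + s + a = r + a + s by ring]

lemma isForestWord_flatten {L : List (List ℕ)} (hL : ∀ l ∈ L, IsForestWord 1 l) :
    IsForestWord L.length L.flatten := by
  induction L with
  | nil => simp [IsForestWord]
  | cons l L ih =>
    rw [List.length_cons, add_comm, List.flatten_cons]
    exact (hL l (by simp)).append (ih fun l' h => hL l' (by simp [h]))

lemma isForestWord_word (t : PlaneTree) : IsForestWord 1 t.word := by
  induction t with
  | node n f ih =>
    simp only [word, IsForestWord, zero_add]
    simpa using isForestWord_flatten (L := List.ofFn fun i => word (f i)) (by
      simpa [List.mem_ofFn] using ih)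

/-- After a first letter `a` the rest parses into `r + a` trees; the first `a` of them become the
children of a new root. -/
lemma IsForestWord.exists_trees {r : ℕ} {l : List ℕ} (h : IsForestWord r l) :
    ∃ ts : List PlaneTree, ts.length = r ∧ l = (ts.map word).flatten := by
  induction l generalizing r with
  | nil =>
    cases r with
    | zero => exact ⟨[], rfl, rfl⟩
    | succ r => simp [IsForestWord] at h
  | cons a l ih =>
    cases r with
    | zero => simp [IsForestWord] at h
    | succ r =>
      obtain ⟨ts, hts, hl⟩ := ih h
      refine ⟨node a (fun i => ts[i.1]'(by omega)) :: ts.drop a, by simp; omega, ?_⟩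
      have h1 : (List.ofFn fun i : Fin a => word (ts[i.1]'(by omega))) = (ts.take a).map word := by
        apply List.ext_getElem
        · simp; omega
        · intro i h1 h2; simp
      simp only [List.map_cons, List.flatten_cons, word, h1, List.cons_append, List.cons.injEq,
        true_and]
      rw [← List.flatten_append, ← List.map_append, List.take_append_drop, hl]

lemma IsForestWord.exists_tree {l : List ℕ} (h : IsForestWord 1 l) :
    ∃ t : PlaneTree, t.word = l := by
  obtain ⟨ts, hts, hl⟩ := h.exists_trees
  obtain ⟨t, rfl⟩ := List.length_eq_one_iff.mp hts
  exact ⟨t, by simp [hl]⟩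

lemma flatten_ofFn_word_inj {n : ℕ} {f : Fin n → PlaneTree}
    (hf : ∀ i (t' : PlaneTree) (x x' : List ℕ), (f i).word ++ x = t'.word ++ x' → f i = t' ∧ x = x')
    {g : Fin n → PlaneTree} {x x' : List ℕ}
    (h : (List.ofFn fun i => word (f i)).flatten ++ x =
      (List.ofFn fun i => word (g i)).flatten ++ x') : f = g ∧ x = x' := by
  induction n with
  | zero => exact ⟨Subsingleton.elim _ _, by simpa using h⟩
  | succ n ih =>
    simp only [List.ofFn_succ, List.flatten_cons, List.append_assoc] at h
    obtain ⟨h0, h1⟩ := hf 0 _ _ _ h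
    obtain ⟨h2, h3⟩ := ih (fun i => hf i.succ) h1
    refine ⟨?_, h3⟩
    funext i
    refine Fin.cases h0 (fun j => congrFun h2 j) i

/-- Unique parsing of tree words. -/
lemma word_append_inj {t t' : PlaneTree} {x x' : List ℕ} (h : t.word ++ x = t'.word ++ x') :
    t = t' ∧ x = x' := by
  induction t generalizing t' x x' with
  | node n f ih =>
    obtain ⟨m, g⟩ := t'
    simp only [word, List.cons_append, List.cons.injEq] at h
    obtain ⟨rfl, h⟩ := h
    obtain ⟨h1, h2⟩ := flatten_ofFn_word_inj (fun i t' x x' h => ih i h) h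
    exact ⟨h1 ▸ rfl, h2⟩

lemma word_injective : Function.Injective word := fun t t' h =>
  (word_append_inj (x := []) (x' := []) (by simpa using h)).1

/-- Lets events be split into countable unions over trees. -/
instance : Countable PlaneTree := word_injective.countable

lemma word_ne_nil (t : PlaneTree) : t.word ≠ [] := by
  cases t; simp [word]

lemma length_word_pos (t : PlaneTree) : 0 < t.word.length :=
  List.length_pos_iff.mpr (word_ne_nil t)

lemma sum_word_add_one (t : PlaneTree) : t.word.sum + 1 = t.word.length := by
  have := (isForestWord_word t).drift_eq
  simp only [drift] at this
  omega

/-! ### The cycle lemma. -/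

lemma exists_low_point (l : List ℕ) : ∃ x y, l = x ++ y ∧
    (∀ u v, y = u ++ v → 0 ≤ drift u) ∧ (∀ u v, x = u ++ v → v ≠ [] → drift x < drift u) := by
  induction l with
  | nil => exact ⟨[], [], rfl, by simp, by simp⟩
  | cons a l ih =>
    obtain ⟨x, y, rfl, hy, hx⟩ := ih
    -- The cut is at the first minimum of the walk: prepending `a` keeps the old cut if its level is
    -- below the start; otherwise the empty prefix takes over.
    by_cases h : drift (a :: x) < 0
    · refine ⟨a :: x, y, rfl, hy, fun u v huv hv => ?_⟩
      cases u with
      | nil => simpa using h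
      | cons b u =>
        simp only [List.cons_append, List.cons.injEq] at huv
        obtain ⟨rfl, huv⟩ := huv
        have := hx u v huv hv
        simpa using this
    · refine ⟨[], a :: (x ++ y), rfl, fun u v huv => ?_, by simp⟩
      cases u with
      | nil => simp
      | cons b u =>
        simp only [List.cons_append, List.cons.injEq] at huv
        obtain ⟨rfl, huv⟩ := huv
        have key : drift x ≤ drift u := by
          rcases List.append_eq_append_iff.mp huv with ⟨z, rfl, h2⟩ | ⟨z, rfl, h2⟩
          · have := hy z v h2; simp; exact this
          · by_cases hz : z = []
            · simp [hz]
            · exact (hx u z rfl hz).le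
        simp only [drift_cons] at h ⊢
        linarith

/-- Cycle lemma, existence: a word of drift `-1` has a rotation that is the word of a tree. -/
lemma exists_rotate_eq_word {l : List ℕ} (hl : l.sum + 1 = l.length) :
    ∃ t : PlaneTree, ∃ i < t.word.length, t.word.rotate i = l := by
  have hd : drift l = -1 := by simp only [drift]; omega
  obtain ⟨x, y, rfl, hy, hx⟩ := exists_low_point l
  have hF : IsForestWord 1 (y ++ x) := by
    refine isForestWord_of_drift (by simp at hd ⊢; linarith) fun u v huv hv => ?_
    rcases List.append_eq_append_iff.mp huv with ⟨z, rfl, h2⟩ | ⟨z, rfl, h2⟩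
    · have := hx z v h2 hv
      simp at hd this ⊢; linarith
    · have := hy u z rfl
      push_cast; linarith
  obtain ⟨t, ht⟩ := hF.exists_tree
  -- For empty `x` the shift `y.length` would be a full turn, outside the allowed range, so the
  -- index 0 is used.
  by_cases h : x = []
  · refine ⟨t, 0, length_word_pos t, by simp [ht, h]⟩
  · refine ⟨t, y.length, ?_, by rw [ht, List.rotate_append_length_eq]⟩
    have := List.length_pos_iff.mpr h
    simp [ht]; exact this

/-- A proper prefix of a tree word has drift at least 0. For 0 < i both pieces of the cut are proper
prefixes, one of `t.word` and one of `t'.word`, yet their drifts add up to -1. -/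
lemma word_rotate_eq_word {t t' : PlaneTree} {i : ℕ} (hi : i < t.word.length)
    (h : t.word.rotate i = t'.word) : i = 0 := by
  by_contra h0
  rw [List.rotate_eq_drop_append_take hi.le] at h
  have h1 := IsForestWord.drift_prefix (r := 1) (x := t.word.take i) (y := t.word.drop i)
  have h2 := IsForestWord.drift_prefix (r := 1) (x := t.word.drop i) (y := t.word.take i)
  have h3 := (isForestWord_word t).drift_eq
  rw [List.take_append_drop] at h1
  rw [h] at h2
  rw [← List.take_append_drop i t.word, drift_append] at h3
  have h4 := h1 (isForestWord_word t) (by simp; omega)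
  have h5 := h2 (isForestWord_word t') (by simp [word_ne_nil]; omega)
  push_cast at *
  omega

/-- Cycle lemma, uniqueness. -/
lemma word_rotate_inj {t t' : PlaneTree} {i i' : ℕ} (hi : i < t.word.length)
    (hi' : i' < t'.word.length) (h : t.word.rotate i = t'.word.rotate i') :
    t = t' ∧ i = i' := by
  wlog hii : i' ≤ i generalizing t t' i i'
  · have := this hi' hi h.symm (by omega)
    exact ⟨this.1.symm, this.2.symm⟩
  have h1 : (t.word.rotate (i - i')).rotate i' = t'.word.rotate i' := by
    rw [List.rotate_rotate, Nat.sub_add_cancel hii, h]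
  have h2 := List.rotate_injective _ h1
  have h3 := word_rotate_eq_word (by omega) h2
  rw [h3, List.rotate_zero] at h2
  exact ⟨word_injective h2, by omega⟩

/-! ### Subtrees as factors of the word, and runs of ones. -/

lemma suffix_flatten {L : List (List ℕ)} {x y : List ℕ} (h : x ++ y = L.flatten) (hy : y ≠ []) :
    ∃ l ∈ L, ∃ x' y' z, l = x' ++ y' ∧ y' ≠ [] ∧ y = y' ++ z := by
  induction L generalizing x with
  | nil => simp_all
  | cons l L ih =>
    rw [List.flatten_cons] at h
    rcases List.append_eq_append_iff.mp h with ⟨z, h1, h2⟩ | ⟨z, h1, h2⟩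
    · by_cases hz : z = []
      · subst hz
        obtain ⟨l', hl', r⟩ := ih (x := []) (by simpa using h2)
        exact ⟨l', by simp [hl'], r⟩
      · exact ⟨l, by simp, x, z, L.flatten, h1, hz, h2⟩
    · obtain ⟨l', hl', r⟩ := ih h2.symm
      exact ⟨l', by simp [hl'], r⟩

/-- Every nonempty suffix of a tree word begins with the word of a subtree. -/
lemma exists_isSubtree_of_suffix {t : PlaneTree} {x y : List ℕ} (h : t.word = x ++ y)
    (hy : y ≠ []) : ∃ s : PlaneTree, s.IsSubtree t ∧ ∃ z, y = s.word ++ z := by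
  induction t generalizing x y with
  | node n f ih =>
    cases x with
    | nil => exact ⟨_, .refl _, [], by simpa using h.symm⟩
    | cons a x =>
      simp only [word, List.cons_append, List.cons.injEq] at h
      obtain ⟨l, hl, x', y', z, h1, h2, rfl⟩ := suffix_flatten h.2.symm hy
      obtain ⟨i, rfl⟩ := List.mem_ofFn.mp hl
      obtain ⟨s, hs, z', rfl⟩ := ih i h1 h2
      exact ⟨s, .child i hs, z' ++ z, by simp⟩

lemma PlaneTree.IsSubtree.exists_word_eq {s t : PlaneTree} (h : s.IsSubtree t) :
    ∃ x y, t.word = x ++ s.word ++ y := by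
  induction h with
  | refl => exact ⟨[], [], by simp⟩
  | @child n f i h ih =>
    obtain ⟨x, y, hxy⟩ := ih
    have : (f i).word ∈ List.ofFn fun i => word (f i) := List.mem_ofFn.mpr ⟨i, rfl⟩
    obtain ⟨L, R, hLR⟩ := List.append_of_mem this
    refine ⟨n :: (L.flatten ++ x), y ++ R.flatten, ?_⟩
    simp [word, hLR, hxy]

/-- Each leading letter 1 is a node with a single child, whose word starts at the next letter. -/
lemma leafHeightGE_of_replicate {h : ℕ} {s : PlaneTree} {z y : List ℕ}
    (hs : s.word ++ z = List.replicate h 1 ++ y) : LeafHeightGE h s := by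
  induction h generalizing s z with
  | zero => simp [LeafHeightGE]
  | succ h ih =>
    obtain ⟨n, f⟩ := s
    simp only [word, List.replicate_succ, List.cons_append, List.cons.injEq] at hs
    obtain ⟨rfl, hs⟩ := hs
    refine ⟨one_ne_zero, fun i => ?_⟩
    rw [Subsingleton.elim i 0]
    exact ih (by simpa using hs)

lemma exists_isSubtree_leafHeightGE {t : PlaneTree} {h : ℕ}
    (ht : List.replicate h 1 <:+: t.word) :
    ∃ s : PlaneTree, s.IsSubtree t ∧ LeafHeightGE h s := by
  rcases Nat.eq_zero_or_pos h with rfl | hh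
  · exact ⟨t, .refl t, by simp [LeafHeightGE]⟩
  obtain ⟨x, y, hxy⟩ := ht
  obtain ⟨s, hs, z, hz⟩ := exists_isSubtree_of_suffix (x := x) (y := List.replicate h 1 ++ y)
    (by rw [← hxy, List.append_assoc]) (by simp; omega)
  exact ⟨s, hs, leafHeightGE_of_replicate hz.symm⟩

lemma PlaneTree.LeafHeightGE.lt_length {h : ℕ} {t : PlaneTree} (ht : LeafHeightGE h t) :
    h < t.word.length := by
  induction h generalizing t with
  | zero => exact length_word_pos t
  | succ h ih =>
    obtain ⟨n, f⟩ := t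
    obtain ⟨hn, hf⟩ := ht
    obtain ⟨n, rfl⟩ := Nat.exists_eq_succ_of_ne_zero hn
    have := ih (hf 0)
    simp [word, List.ofFn_succ]
    omega

/-! ### Word weights and the law of a sum of independent letters. -/

/-- The probability that i.i.d. letters with law `p` spell the word `l`. -/
noncomputable def wordWeight (p : PMF ℕ) (l : List ℕ) : ℝ≥0∞ := (l.map p).prod

/-- The probability that a sum of `n` independent variables with law `p` equals `k`. -/
noncomputable def sumProb (p : PMF ℕ) (n k : ℕ) : ℝ≥0∞ :=
  ∑' l : List ℕ, if l.length = n ∧ l.sum = k then wordWeight p l else 0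

@[simp] lemma wordWeight_nil (p : PMF ℕ) : wordWeight p [] = 1 := rfl

@[simp] lemma wordWeight_cons (p : PMF ℕ) (a : ℕ) (l : List ℕ) :
    wordWeight p (a :: l) = p a * wordWeight p l := by simp [wordWeight]

@[simp] lemma wordWeight_append (p : PMF ℕ) (x y : List ℕ) :
    wordWeight p (x ++ y) = wordWeight p x * wordWeight p y := by simp [wordWeight]

lemma wordWeight_perm (p : PMF ℕ) {x y : List ℕ} (h : x.Perm y) :
    wordWeight p x = wordWeight p y := (h.map p).prod_eq

lemma tsum_list (F : List ℕ → ℝ≥0∞) :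
    ∑' l, F l = F [] + ∑' a : ℕ, ∑' l, F (a :: l) := by
  let e : Unit ⊕ (ℕ × List ℕ) ≃ List ℕ :=
    { toFun := fun o => o.elim (fun _ => []) fun q => q.1 :: q.2
      invFun := fun l => match l with
        | [] => .inl ()
        | a :: l => .inr (a, l)
      left_inv := by rintro (_ | ⟨a, l⟩) <;> rfl
      right_inv := by rintro (_ | ⟨a, l⟩) <;> rfl }
  rw [← e.tsum_eq, Summable.tsum_sum ENNReal.summable ENNReal.summable, ← ENNReal.tsum_prod]
  simp [e]

lemma sumProb_zero (p : PMF ℕ) (k : ℕ) : sumProb p 0 k = if k = 0 then 1 else 0 := by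
  rw [sumProb, tsum_list]
  simp [eq_comm]

lemma sumProb_succ (p : PMF ℕ) (n k : ℕ) :
    sumProb p (n + 1) k = ∑' a, p a * if a ≤ k then sumProb p n (k - a) else 0 := by
  rw [sumProb, tsum_list]
  simp only [List.length_nil, List.length_cons, List.sum_cons, wordWeight_cons, sumProb]
  rw [if_neg (by simp), zero_add]
  refine tsum_congr fun a => ?_
  split_ifs with h
  · rw [← ENNReal.tsum_mul_left]
    refine tsum_congr fun l => ?_
    rw [mul_ite, mul_zero]
    congr 1
    simp only [eq_iff_iff]; omega
  · rw [mul_zero, ENNReal.tsum_eq_zero]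
    intro l
    rw [if_neg (by omega)]

/-- The law of a sum of `n` independent variables with law `p`. -/
noncomputable def sumLaw (p : PMF ℕ) : ℕ → Measure ℕ
  | 0 => Measure.dirac 0
  | n + 1 => p.toMeasure.conv (sumLaw p n)

instance (p : PMF ℕ) (n : ℕ) : IsProbabilityMeasure (sumLaw p n) := by
  induction n with
  | zero => unfold sumLaw; infer_instance
  | succ n ih => unfold sumLaw; infer_instance

lemma sumLaw_singleton (p : PMF ℕ) (n k : ℕ) : sumLaw p n {k} = sumProb p n k := by
  induction n generalizing k with
  | zero => simp [sumLaw, sumProb_zero, Set.indicator, eq_comm]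
  | succ n ih =>
    rw [sumProb_succ, sumLaw, ← lintegral_indicator_one (measurableSet_singleton k),
      Measure.lintegral_conv (measurable_from_top), lintegral_countable']
    refine tsum_congr fun a => ?_
    rw [PMF.toMeasure_apply_singleton _ _ (measurableSet_singleton a), mul_comm]
    congr 1
    split_ifs with h
    · rw [← ih, ← lintegral_indicator_one (measurableSet_singleton _)]
      congr with x
      simp only [Set.indicator, Set.mem_singleton_iff]
      congr 1
      simp only [eq_iff_iff]; omega
    · rw [← lintegral_zero (μ := sumLaw p n)]
      congr with x
      simp only [Set.indicator, Set.mem_singleton_iff]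
      rw [if_neg (by omega)]

/-! ### Fourier inversion and the uniform local upper bound. -/

/-- The characteristic function of `p`. -/
noncomputable def pmfChar (p : PMF ℕ) (t : ℝ) : ℂ :=
  ∫ a : ℕ, Complex.exp (t * a * Complex.I) ∂p.toMeasure

lemma integral_exp_sumLaw (p : PMF ℕ) (n : ℕ) (t : ℝ) :
    ∫ a : ℕ, Complex.exp (t * a * Complex.I) ∂(sumLaw p n) = pmfChar p t ^ n := by
  induction n with
  | zero => simp [sumLaw]
  | succ n ih =>
    rw [sumLaw, integral_conv, pow_succ', ← ih, pmfChar, ← integral_mul_const]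
    · congr with a
      rw [← integral_const_mul]
      congr with b
      rw [← Complex.exp_add]
      push_cast; ring_nf
    · refine (integrable_const (1 : ℝ)).mono (measurable_from_top.aestronglyMeasurable) ?_
      refine ae_of_all _ fun a => ?_
      rw [show (t * a * Complex.I : ℂ) = ((t * a : ℝ) : ℂ) * Complex.I by push_cast; ring,
        Complex.norm_exp_ofReal_mul_I]
      simp

lemma integral_exp_int (m : ℤ) :
    ∫ t in (-Real.pi)..Real.pi, Complex.exp (t * m * Complex.I) =
      if m = 0 then 2 * (Real.pi : ℂ) else 0 := by
  split_ifs with h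
  · simp [h]; ring
  · have hc : (m * Complex.I : ℂ) ≠ 0 := by simp [h]
    have := integral_exp_mul_complex (a := -Real.pi) (b := Real.pi) hc
    rw [show (fun t : ℝ => Complex.exp (t * m * Complex.I)) =
      fun t : ℝ => Complex.exp (m * Complex.I * t) by ext; ring_nf, this, div_eq_zero_iff]
    left
    rw [sub_eq_zero, Complex.exp_eq_exp_iff_exists_int]
    exact ⟨m, by push_cast; ring⟩

lemma sumProb_fourier (p : PMF ℕ) (n k : ℕ) :
    2 * (Real.pi : ℂ) * ((sumProb p n k).toReal : ℂ) =
      ∫ t in (-Real.pi)..Real.pi, pmfChar p t ^ n * Complex.exp (-(t * k * Complex.I)) := by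
  have h1 : ∀ t : ℝ, pmfChar p t ^ n * Complex.exp (-(t * k * Complex.I)) =
      ∫ a : ℕ, Complex.exp (t * ((a : ℤ) - (k : ℤ) : ℤ) * Complex.I) ∂(sumLaw p n) := by
    intro t
    rw [← integral_exp_sumLaw, ← integral_mul_const]
    congr with a
    rw [← Complex.exp_add]
    push_cast; ring_nf
  simp_rw [h1]
  rw [intervalIntegral_integral_swap]
  · simp_rw [integral_exp_int]
    rw [← sumLaw_singleton, ← measureReal_def, ← integral_indicator_one (measurableSet_singleton k)]
    rw [← integral_complex_ofReal, ← integral_const_mul]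
    congr with a
    by_cases h : a = k
    · simp [h]
    · have : (a : ℤ) - k ≠ 0 := by omega
      simp [h, this]
  · have : IsFiniteMeasure (volume.restrict (Set.uIoc (-Real.pi) Real.pi)) :=
      ⟨by rw [Measure.restrict_apply_univ]; simp [Set.uIoc]⟩
    refine (integrable_const (1 : ℝ)).mono ?_ ?_
    · apply Measurable.aestronglyMeasurable
      apply measurable_from_prod_countable_left
      intro a
      dsimp
      fun_prop
    · refine ae_of_all _ fun a => ?_
      dsimp only [Function.uncurry]
      rw [show (a.1 * ((a.2 : ℤ) - (k : ℤ) : ℤ) * Complex.I : ℂ) =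
        ((a.1 * ((a.2 : ℤ) - (k : ℤ) : ℤ) : ℝ) : ℂ) * Complex.I by push_cast; ring,
        Complex.norm_exp_ofReal_mul_I]
      simp

lemma sum_toReal_le_one (p : PMF ℕ) : (p 0).toReal + (p 1).toReal ≤ 1 := by
  rw [← ENNReal.toReal_add (p.apply_ne_top 0) (p.apply_ne_top 1)]
  refine ENNReal.toReal_mono ENNReal.one_ne_top ?_ |>.trans_eq ENNReal.toReal_one
  have := ENNReal.sum_le_tsum (f := p) {0, 1}
  rwa [Finset.sum_pair (by simp), p.tsum_coe] at this

lemma norm_exp_mul_I (t : ℝ) (a : ℕ) : ‖Complex.exp (t * a * Complex.I)‖ = 1 := by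
  rw [show (t * a * Complex.I : ℂ) = ((t * a : ℝ) : ℂ) * Complex.I by push_cast; ring,
    Complex.norm_exp_ofReal_mul_I]

lemma integrable_exp_mul_I (μ : Measure ℕ) [IsFiniteMeasure μ] (t : ℝ) :
    Integrable (fun a : ℕ => Complex.exp (t * a * Complex.I)) μ :=
  (integrable_const (1 : ℝ)).mono measurable_from_top.aestronglyMeasurable
    (ae_of_all _ fun a => by rw [norm_exp_mul_I]; simp)

/-- Only the interference of the atoms at 0 and 1 is exploited; all other atoms are bounded by their
mass. Two adjacent atoms already exclude periodicity. -/
lemma norm_pmfChar_le_add (p : PMF ℕ) (t : ℝ) :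
    ‖pmfChar p t‖ ≤ ‖((p 0).toReal + (p 1).toReal * Complex.exp (t * Complex.I) : ℂ)‖ +
      (1 - (p 0).toReal - (p 1).toReal) := by
  have hint := integrable_exp_mul_I p.toMeasure t
  have hs : MeasurableSet (({0, 1} : Finset ℕ) : Set ℕ) := trivial
  have hr : ∀ a, p.toMeasure.real {a} = (p a).toReal := fun a => by
    rw [measureReal_def, PMF.toMeasure_apply_singleton _ _ (measurableSet_singleton a)]
  rw [pmfChar, ← integral_add_compl hs hint]
  refine (norm_add_le _ _).trans (add_le_add (le_of_eq ?_) ?_)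
  · rw [setIntegral_finset _ hint.integrableOn, Finset.sum_pair (by simp)]
    simp [hr]
  · refine (norm_setIntegral_le_of_norm_le_const (C := 1) (measure_lt_top _ _)
      fun a _ => (norm_exp_mul_I t a).le).trans ?_
    rw [one_mul, probReal_compl_eq_one_sub hs,
      ← sum_measureReal_singleton, Finset.sum_pair (by simp), hr, hr]
    linarith

lemma norm_add_mul_exp_sq (a b t : ℝ) :
    ‖(a + b * Complex.exp (t * Complex.I) : ℂ)‖ ^ 2 = (a + b) ^ 2 - 2 * a * b * (1 - Real.cos t) := by
  rw [Complex.sq_norm, Complex.normSq_apply]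
  simp only [Complex.add_re, Complex.ofReal_re, Complex.mul_re, Complex.exp_ofReal_mul_I_re,
    Complex.ofReal_im, Complex.exp_ofReal_mul_I_im, Complex.add_im, Complex.mul_im]
  linear_combination b ^ 2 * Real.sin_sq_add_cos_sq t

/-- The constant of the quadratic bound for the characteristic function near `0`. -/
noncomputable def charConst (p : PMF ℕ) : ℝ := 2 * (p 0).toReal * (p 1).toReal / Real.pi ^ 2

lemma charConst_pos {p : PMF ℕ} (h0 : p 0 ≠ 0) (h1 : p 1 ≠ 0) : 0 < charConst p := by
  have := ENNReal.toReal_pos h0 (p.apply_ne_top 0)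
  have := ENNReal.toReal_pos h1 (p.apply_ne_top 1)
  unfold charConst
  positivity

lemma norm_pmfChar_le (p : PMF ℕ) {t : ℝ} (ht : |t| ≤ Real.pi) :
    ‖pmfChar p t‖ ≤ Real.exp (-(charConst p * t ^ 2)) := by
  have hsum := sum_toReal_le_one p
  have hadd := norm_pmfChar_le_add p t
  have hsq := norm_add_mul_exp_sq (p 0).toReal (p 1).toReal t
  have hcos := Real.cos_le_one_sub_mul_cos_sq ht
  have ha : 0 ≤ (p 0).toReal := ENNReal.toReal_nonneg
  have hb : 0 ≤ (p 1).toReal := ENNReal.toReal_nonneg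
  rw [charConst]
  set a := (p 0).toReal
  set b := (p 1).toReal
  have hpi := Real.pi_pos
  have hab := mul_nonneg ha hb
  have ht2 : t ^ 2 ≤ Real.pi ^ 2 := sq_le_sq' (abs_le.mp ht).1 (abs_le.mp ht).2
  -- From 1 - cos t ≥ 2 t² / π² the squared norm of the two-atom part is at most (a + b)² - 2x,
  -- hence at most (a + b - x)² because a + b ≤ 1.
  set x := 2 * a * b / Real.pi ^ 2 * t ^ 2 with hx
  have hx0 : 0 ≤ x := by positivity
  have hxs : x ≤ 2 * (a * b) := by
    rw [hx, div_mul_eq_mul_div, div_le_iff₀ (by positivity)]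
    nlinarith
  have hnorm : ‖(a + b * Complex.exp (t * Complex.I) : ℂ)‖ ≤ a + b - x := by
    refine le_of_sq_le_sq ?_ ?_
    · rw [hsq]
      have : 2 * x ≤ 2 * a * b * (1 - Real.cos t) := by
        have : 2 * x = 2 * a * b * (2 / Real.pi ^ 2 * t ^ 2) := by rw [hx]; ring
        rw [this]
        refine mul_le_mul_of_nonneg_left (by linarith) (by positivity)
      nlinarith
    · nlinarith
  have := Real.add_one_le_exp (-x)
  linarith

lemma continuous_pmfChar (p : PMF ℕ) : Continuous (pmfChar p) := by
  refine continuous_of_dominated (bound := fun _ => 1)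
    (fun t => measurable_from_top.aestronglyMeasurable)
    (fun t => ae_of_all _ fun a => (norm_exp_mul_I t a).le) (integrable_const _)
    (ae_of_all _ fun a => by fun_prop)

lemma norm_exp_neg_mul_I (t : ℝ) (a : ℕ) : ‖Complex.exp (-(t * a * Complex.I))‖ = 1 := by
  rw [Complex.exp_neg, norm_inv, norm_exp_mul_I, inv_one]

lemma sumProb_le_of_pos {p : PMF ℕ} (h0 : p 0 ≠ 0) (h1 : p 1 ≠ 0) {n : ℕ} (hn : 0 < n) (k : ℕ) :
    2 * Real.pi * (sumProb p n k).toReal ≤ √(Real.pi / (n * charConst p)) := by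
  have hc := charConst_pos h0 h1
  have hn' : (0 : ℝ) < n := by exact_mod_cast hn
  have h := congrArg norm (sumProb_fourier p n k)
  rw [show ‖2 * (Real.pi : ℂ) * ((sumProb p n k).toReal : ℂ)‖ =
    2 * Real.pi * (sumProb p n k).toReal by
      simp [abs_of_pos Real.pi_pos, abs_of_nonneg]] at h
  rw [h, ← integral_gaussian]
  have hpi : -Real.pi ≤ Real.pi := by linarith [Real.pi_pos]
  have hg : Integrable fun t : ℝ => Real.exp (-(n * charConst p) * t ^ 2) :=
    integrable_exp_neg_mul_sq (by positivity)
  refine (intervalIntegral.norm_integral_le_of_norm_le hpi (ae_of_all _ fun t ht => ?_)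
    (hg.intervalIntegrable)).trans ?_
  · rw [norm_mul, norm_exp_neg_mul_I, mul_one, norm_pow]
    refine (pow_le_pow_left₀ (norm_nonneg _) (norm_pmfChar_le p
      (abs_le.mpr ⟨ht.1.le, ht.2⟩)) n).trans_eq ?_
    rw [← Real.exp_nat_mul]
    ring_nf
  · rw [intervalIntegral.integral_of_le hpi]
    exact setIntegral_le_integral hg (ae_of_all _ fun t => (Real.exp_pos _).le)

lemma sumProb_le_one (p : PMF ℕ) (n k : ℕ) : sumProb p n k ≤ 1 := by
  rw [← sumLaw_singleton]; exact prob_le_one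

/-- The shift to n + 1 keeps the bound meaningful at n = 0, which occurs later as n - m with m = n.
-/
lemma exists_sumProb_le {p : PMF ℕ} (h0 : p 0 ≠ 0) (h1 : p 1 ≠ 0) :
    ∃ C : ℝ, 0 < C ∧ ∀ n k, (sumProb p n k).toReal ≤ C / √(n + 1) := by
  have hc := charConst_pos h0 h1
  refine ⟨1 + √(2 * Real.pi / charConst p), by positivity, fun n k => ?_⟩
  rcases Nat.eq_zero_or_pos n with rfl | hn
  · have := ENNReal.toReal_mono ENNReal.one_ne_top (sumProb_le_one p 0 k)
    simp at this ⊢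
    linarith [Real.sqrt_nonneg (2 * Real.pi / charConst p)]
  · have hn' : (1 : ℝ) ≤ n := by exact_mod_cast hn
    have h := sumProb_le_of_pos h0 h1 hn k
    have h2 : √(Real.pi / (n * charConst p)) ≤ √(2 * Real.pi / charConst p) / √(n + 1) := by
      rw [← Real.sqrt_div' _ (by positivity)]
      refine Real.sqrt_le_sqrt ?_
      rw [div_div, div_le_div_iff₀ (by positivity) (by positivity)]
      nlinarith [mul_pos Real.pi_pos hc]
    have h3 : √(2 * Real.pi / charConst p) / √(n + 1) ≤
        (1 + √(2 * Real.pi / charConst p)) / √(n + 1) := by gcongr; linarith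
    have h4 : (0 : ℝ) ≤ (sumProb p n k).toReal := ENNReal.toReal_nonneg
    nlinarith [Real.pi_gt_three]

/-! ### Local limit theorem at n - 1, from the central limit theorem. -/

section LowerBound

variable {p : PMF ℕ}

lemma integrable_natCast (hfin : MemLp (fun i : ℕ => (i : ℝ)) 2 p.toMeasure) :
    Integrable (fun i : ℕ => (i : ℝ)) p.toMeasure :=
  hfin.integrable (by norm_num)

lemma tendsto_pmfChar_pow (hfin : MemLp (fun i : ℕ => (i : ℝ)) 2 p.toMeasure)
    (hmean : ∫ i : ℕ, (i : ℝ) ∂p.toMeasure = 1) {σ : ℝ} (hσ : 0 < σ)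
    (hvar : σ ^ 2 = variance (fun i : ℕ => (i : ℝ)) p.toMeasure) (s : ℝ) :
    Tendsto (fun n : ℕ => (pmfChar p (s / (σ * √n)) *
      Complex.exp (-((s / (σ * √n) : ℝ) * Complex.I))) ^ n) atTop
      (𝓝 (Complex.exp (-s ^ 2 / 2))) := by
  have hX : AEMeasurable (fun i : ℕ => ((i : ℝ) - 1) / σ) p.toMeasure :=
    measurable_from_top.aemeasurable
  have hi := integrable_natCast hfin
  rw [variance_eq_integral hi.1.aemeasurable, hmean] at hvar
  have h := tendsto_charFun_inv_sqrt_mul_pow hX (by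
      rw [integral_div, integral_sub hi (integrable_const _), hmean]; simp) (by
      simp only [Pi.pow_apply, div_pow]
      rw [integral_div, ← hvar, div_self (by positivity)]) s
  refine h.congr fun n => ?_
  congr 1
  rw [charFun_apply_real, integral_map hX (by fun_prop), pmfChar, ← integral_mul_const]
  congr with a
  rw [← Complex.exp_add]
  congr 1
  have : (σ : ℂ) ≠ 0 := by exact_mod_cast hσ.ne'
  push_cast
  rw [← div_div]
  ring

/-- Substituting t = s / (σ√n) in the inversion integral, the integrand converges to exp(-s²/2) by
the central limit theorem and is dominated by a Gaussian through `norm_pmfChar_le`. -/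
lemma tendsto_sumProb (h0 : p 0 ≠ 0) (h1 : p 1 ≠ 0)
    (hfin : MemLp (fun i : ℕ => (i : ℝ)) 2 p.toMeasure)
    (hmean : ∫ i : ℕ, (i : ℝ) ∂p.toMeasure = 1) {σ : ℝ} (hσ : 0 < σ)
    (hvar : σ ^ 2 = variance (fun i : ℕ => (i : ℝ)) p.toMeasure) :
    Tendsto (fun n : ℕ => σ * √n * (2 * Real.pi * (sumProb p n (n - 1)).toReal)) atTop
      (𝓝 √(2 * Real.pi)) := by
  have hc := charConst_pos h0 h1
  -- The n-th power is centred at n; the extra exponential, tending to 1, accounts for the target n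
  -- - 1.
  set F : ℕ → ℝ → ℂ := fun n s => (Set.Ioc (-(Real.pi * (σ * √n))) (Real.pi * (σ * √n))).indicator
    (fun s : ℝ => (pmfChar p (s / (σ * √n)) * Complex.exp (-((s / (σ * √n) : ℝ) * Complex.I))) ^ n *
      Complex.exp ((s / (σ * √n) : ℝ) * Complex.I)) s with hF
  have hFint : ∀ n : ℕ, 0 < n → ∫ s, F n s =
      ((σ * √n * (2 * Real.pi * (sumProb p n (n - 1)).toReal) : ℝ) : ℂ) := by
    intro n hn
    have hd : 0 < σ * √n := by positivity
    have hle : -(Real.pi * (σ * √n)) ≤ Real.pi * (σ * √n) := by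
      have : 0 < Real.pi * (σ * √n) := by positivity
      linarith
    rw [hF]
    simp only
    rw [integral_indicator measurableSet_Ioc, ← intervalIntegral.integral_of_le hle]
    rw [intervalIntegral.integral_comp_div (fun t : ℝ => (pmfChar p t *
      Complex.exp (-(t * Complex.I))) ^ n * Complex.exp (t * Complex.I)) hd.ne']
    rw [← neg_mul, mul_div_cancel_right₀ _ hd.ne', mul_div_cancel_right₀ _ hd.ne']
    push_cast
    rw [sumProb_fourier, Complex.real_smul]
    push_cast
    congr 1
    refine intervalIntegral.integral_congr fun t _ => ?_
    rw [mul_pow, mul_assoc, ← Complex.exp_nat_mul, ← Complex.exp_add]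
    congr 2
    rw [Nat.cast_sub hn]
    push_cast; ring
  have hbound : ∀ (n : ℕ) (s : ℝ), ‖F n s‖ ≤ Real.exp (-(charConst p / σ ^ 2) * s ^ 2) := by
    intro n s
    rcases Nat.eq_zero_or_pos n with rfl | hn
    · simp [hF]; positivity
    have hd : 0 < σ * √n := by positivity
    rw [hF]
    simp only
    by_cases hs : s ∈ Set.Ioc (-(Real.pi * (σ * √n))) (Real.pi * (σ * √n))
    · rw [Set.indicator_of_mem hs, norm_mul, norm_pow, norm_mul, Complex.norm_exp_ofReal_mul_I,
        Complex.exp_neg, norm_inv, Complex.norm_exp_ofReal_mul_I, inv_one, mul_one, mul_one]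
      have hs' : |s / (σ * √n)| ≤ Real.pi := by
        rw [abs_div, abs_of_pos hd, div_le_iff₀ hd, abs_le]
        exact ⟨hs.1.le, hs.2⟩
      refine (pow_le_pow_left₀ (norm_nonneg _) (norm_pmfChar_le p hs') n).trans_eq ?_
      rw [← Real.exp_nat_mul, div_pow, mul_pow, Real.sq_sqrt (by positivity)]
      congr 1
      have : (n : ℝ) ≠ 0 := by positivity
      field_simp
    · rw [Set.indicator_of_notMem hs, norm_zero]
      positivity
  have hlim : ∀ s : ℝ, Tendsto (fun n => F n s) atTop (𝓝 (Complex.exp (-s ^ 2 / 2))) := by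
    intro s
    have hsq : Tendsto (fun n : ℕ => σ * √n) atTop atTop :=
      (Real.tendsto_sqrt_atTop.comp tendsto_natCast_atTop_atTop).const_mul_atTop hσ
    have h2 : Tendsto (fun n : ℕ => Complex.exp ((s / (σ * √n) : ℝ) * Complex.I)) atTop (𝓝 1) := by
      have h3 : Tendsto (fun n : ℕ => s / (σ * √n)) atTop (𝓝 0) := hsq.const_div_atTop s
      have h4 : Continuous fun x : ℝ => Complex.exp (x * Complex.I) := by fun_prop
      have h5 := (h4.tendsto 0).comp h3
      rw [Complex.ofReal_zero, zero_mul, Complex.exp_zero] at h5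
      exact h5
    have h5 := (tendsto_pmfChar_pow hfin hmean hσ hvar s).mul h2
    rw [mul_one] at h5
    refine h5.congr' ?_
    filter_upwards [(hsq.const_mul_atTop Real.pi_pos).eventually_gt_atTop |s|] with n hn
    rw [hF]
    simp only
    rw [Set.indicator_of_mem]
    exact ⟨(abs_lt.mp hn).1, (abs_lt.mp hn).2.le⟩
  have hmeas : ∀ n, AEStronglyMeasurable (F n) := by
    intro n
    refine AEStronglyMeasurable.indicator ?_ measurableSet_Ioc
    refine Continuous.aestronglyMeasurable ?_
    have := continuous_pmfChar p
    fun_prop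
  have hint : Integrable fun s : ℝ => Real.exp (-(charConst p / σ ^ 2) * s ^ 2) :=
    integrable_exp_neg_mul_sq (by positivity)
  have hconv := tendsto_integral_of_dominated_convergence _ hmeas hint
    (fun n => ae_of_all _ (hbound n)) (ae_of_all _ hlim)
  have hg : ∫ s : ℝ, Complex.exp (-s ^ 2 / 2) = ((√(2 * Real.pi) : ℝ) : ℂ) := by
    have := integral_gaussian (1 / 2)
    rw [show Real.pi / (1 / 2) = 2 * Real.pi by ring] at this
    rw [← this, ← integral_complex_ofReal]
    congr with s
    push_cast
    ring_nf
  rw [hg] at hconv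
  have h6 : Tendsto (fun n : ℕ => ((σ * √n * (2 * Real.pi * (sumProb p n (n - 1)).toReal) : ℝ) : ℂ))
      atTop (𝓝 ((√(2 * Real.pi) : ℝ) : ℂ)) := by
    refine hconv.congr' ?_
    filter_upwards [eventually_gt_atTop 0] with n hn using hFint n hn
  exact (Complex.continuous_re.tendsto _).comp h6

lemma exists_le_sumProb (h0 : p 0 ≠ 0) (h1 : p 1 ≠ 0)
    (hfin : MemLp (fun i : ℕ => (i : ℝ)) 2 p.toMeasure)
    (hmean : ∫ i : ℕ, (i : ℝ) ∂p.toMeasure = 1)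
    (hvar : 0 < variance (fun i : ℕ => (i : ℝ)) p.toMeasure) :
    ∃ c : ℝ, 0 < c ∧ ∀ᶠ n : ℕ in atTop, c / √n ≤ (sumProb p n (n - 1)).toReal := by
  have hσ := Real.sqrt_pos.mpr hvar
  have h := tendsto_sumProb h0 h1 hfin hmean hσ (Real.sq_sqrt hvar.le)
  set σ := √(variance (fun i : ℕ => (i : ℝ)) p.toMeasure)
  have h1 : (1 : ℝ) < √(2 * Real.pi) := by
    rw [Real.lt_sqrt (by norm_num)]; linarith [Real.pi_gt_three]
  -- The rescaled probability tends to √(2π) > 1, so it eventually exceeds 1.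
  refine ⟨1 / (2 * Real.pi * σ), by positivity, ?_⟩
  filter_upwards [h.eventually_const_lt h1, eventually_gt_atTop 0] with n hn hn0
  have : (0 : ℝ) < √n := by positivity
  rw [div_div, div_le_iff₀ (by positivity)]
  calc (1 : ℝ) ≤ _ := hn.le
    _ = _ := by ring

end LowerBound

/-- Otherwise ξ ≥ 1 almost surely with mean 1, so ξ = 1 almost surely and the variance vanishes. -/
lemma apply_zero_ne_zero {p : PMF ℕ} (hfin : MemLp (fun i : ℕ => (i : ℝ)) 2 p.toMeasure)
    (hmean : ∫ i : ℕ, (i : ℝ) ∂p.toMeasure = 1)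
    (hvar : 0 < variance (fun i : ℕ => (i : ℝ)) p.toMeasure) : p 0 ≠ 0 := by
  intro h0
  have hi := integrable_natCast hfin
  have hae : ∀ᵐ i ∂p.toMeasure, i ≠ 0 := by
    rw [ae_iff]
    simp only [ne_eq, not_not, Set.ofPred_eq_eq_singleton]
    rw [PMF.toMeasure_apply_singleton _ _ (measurableSet_singleton 0), h0]
  have h2 : (fun i : ℕ => (i : ℝ) - 1) =ᵐ[p.toMeasure] 0 := by
    refine (integral_eq_zero_iff_of_nonneg_ae ?_ (hi.sub (integrable_const 1))).mp ?_
    · filter_upwards [hae] with i hi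
      have : (1 : ℝ) ≤ i := by exact_mod_cast Nat.one_le_iff_ne_zero.mpr hi
      simpa using this
    · change ∫ i : ℕ, ((i : ℝ) - 1) ∂p.toMeasure = 0
      rw [integral_sub hi (integrable_const _), hmean]; simp
  rw [variance_eq_integral hi.1.aemeasurable, hmean] at hvar
  refine hvar.ne' ?_
  rw [integral_eq_zero_of_ae]
  filter_upwards [h2] with i hi
  simp at hi ⊢
  exact hi

/-! ### Comparing sums along injections; sums over trees. -/

lemma tsum_ite_le_tsum {α β : Type*} {S : α → Prop} [DecidablePred S] {F : α → ℝ≥0∞} {G : β → ℝ≥0∞}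
    (R : α → β → Prop) (h : ∀ a, S a → ∃ b, R a b ∧ F a ≤ G b)
    (hR : ∀ a a' b, S a → S a' → R a b → R a' b → a = a') :
    ∑' a, (if S a then F a else 0) ≤ ∑' b, G b := by
  -- The partners may be chosen arbitrarily: `hR` says that a partner determines its source, so any
  -- choice is injective.
  choose e he hF using h
  have h1 : ∑' a, (if S a then F a else 0) = ∑' a : {a // S a}, F a := by
    have := tsum_subtype {a | S a} F
    rw [show (∑' a : {a // S a}, F a) = ∑' a : {a | S a}, F a from rfl, this]
    refine tsum_congr fun a => ?_
    simp [Set.indicator]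
  rw [h1]
  refine (ENNReal.tsum_le_tsum fun a : {a // S a} => hF a.1 a.2).trans
    (ENNReal.tsum_comp_le_tsum_of_injective (f := fun a : {a // S a} => e a.1 a.2) ?_ G)
  intro a a' haa
  refine Subtype.ext (hR a.1 a'.1 _ a.2 a'.2 (he a.1 a.2) ?_)
  simp only at haa
  rw [haa]
  exact he a'.1 a'.2

lemma tsum_pi_prod {α : Type*} (G : α → ℝ≥0∞) (n : ℕ) :
    ∑' f : Fin n → α, ∏ i, G (f i) = (∑' a, G a) ^ n := by
  induction n with
  | zero => simp
  | succ n ih =>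
    rw [← (Fin.consEquiv fun _ => α).tsum_eq, ENNReal.tsum_prod', pow_succ', ← ih,
      ← ENNReal.tsum_mul_right]
    refine tsum_congr fun a => ?_
    rw [← ENNReal.tsum_mul_left]
    refine tsum_congr fun f => ?_
    simp [Fin.consEquiv, Fin.prod_univ_succ]

/-- The number of nodes of a tree. -/
def PlaneTree.card (t : PlaneTree) : ℕ := t.word.length

lemma card_node (n : ℕ) (f : Fin n → PlaneTree) : (node n f).card = (∑ i, (f i).card) + 1 := by
  simp [PlaneTree.card, word, List.length_flatten, List.map_ofFn, List.sum_ofFn]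

lemma wordWeight_flatten (p : PMF ℕ) (L : List (List ℕ)) :
    wordWeight p L.flatten = (L.map (wordWeight p)).prod := by
  induction L with
  | nil => simp
  | cons l L ih => simp [ih]

lemma wordWeight_node (p : PMF ℕ) (n : ℕ) (f : Fin n → PlaneTree) :
    wordWeight p (node n f).word = p n * ∏ i, wordWeight p (f i).word := by
  simp [word, wordWeight_flatten, List.map_ofFn, List.prod_ofFn]

lemma tsum_tree (F : PlaneTree → ℝ≥0∞) :
    ∑' t, F t = ∑' n : ℕ, ∑' f : Fin n → PlaneTree, F (node n f) := by
  let e : (Σ n : ℕ, Fin n → PlaneTree) ≃ PlaneTree :=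
    { toFun := fun q => node q.1 q.2
      invFun := fun t => match t with
        | node n f => ⟨n, f⟩
      left_inv := fun _ => rfl
      right_inv := by rintro ⟨n, f⟩; rfl }
  rw [← e.tsum_eq, ENNReal.tsum_sigma']
  rfl

/-- Truncate at size N and induct: all children of a tree of size at most N + 1 have size at most N,
so the truncated sum is at most Σ p n · 1^n = 1. -/
lemma tsum_wordWeight_le_one (p : PMF ℕ) : ∑' t : PlaneTree, wordWeight p t.word ≤ 1 := by
  have key : ∀ N : ℕ, ∑' t : PlaneTree, (if t.card ≤ N then wordWeight p t.word else 0) ≤ 1 := by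
    intro N
    induction N with
    | zero =>
      rw [ENNReal.tsum_eq_zero.mpr]
      · exact zero_le_one
      · intro t
        have := length_word_pos t
        rw [if_neg (by simp only [PlaneTree.card]; omega)]
    | succ N ih =>
      rw [tsum_tree]
      calc _ ≤ ∑' n : ℕ, ∑' f : Fin n → PlaneTree,
            p n * ∏ i, (if (f i).card ≤ N then wordWeight p (f i).word else 0) := by
            refine ENNReal.tsum_le_tsum fun n => ENNReal.tsum_le_tsum fun f => ?_
            split_ifs with h
            · rw [wordWeight_node]
              refine le_of_eq ?_
              congr 1
              refine Finset.prod_congr rfl fun i _ => ?_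
              rw [card_node] at h
              have := Finset.single_le_sum (f := fun i => (f i).card) (fun _ _ => Nat.zero_le _)
                (Finset.mem_univ i)
              rw [if_pos (by omega)]
            · exact zero_le
        _ ≤ ∑' n : ℕ, p n := by
            refine ENNReal.tsum_le_tsum fun n => ?_
            rw [ENNReal.tsum_mul_left, tsum_pi_prod
              (fun t : PlaneTree => if t.card ≤ N then wordWeight p t.word else 0)]
            exact mul_le_of_le_one_right' (pow_le_one₀ zero_le ih)
        _ = 1 := p.tsum_coe
  rw [ENNReal.tsum_eq_iSup_sum]
  refine iSup_le fun s => ?_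
  refine le_trans ?_ (key (s.sup PlaneTree.card))
  refine le_trans (Finset.sum_le_sum fun t ht => ?_) (ENNReal.sum_le_tsum s)
  rw [if_pos (Finset.le_sup ht)]

/-! ### Leaf-height of the root, alone and jointly with the size. -/

open scoped Classical in
/-- The weight of `t` if its root has leaf-height at least `h`, and zero otherwise. -/
noncomputable def heightWeight (p : PMF ℕ) (h : ℕ) (t : PlaneTree) : ℝ≥0∞ :=
  if LeafHeightGE h t then wordWeight p t.word else 0

lemma heightWeight_zero (p : PMF ℕ) (t : PlaneTree) :
    heightWeight p 0 t = wordWeight p t.word := by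
  simp [heightWeight, LeafHeightGE]

lemma heightWeight_node_zero (p : PMF ℕ) (h : ℕ) (f : Fin 0 → PlaneTree) :
    heightWeight p (h + 1) (node 0 f) = 0 := by
  simp [heightWeight, LeafHeightGE]

lemma heightWeight_node_succ (p : PMF ℕ) (h n : ℕ) (f : Fin (n + 1) → PlaneTree) :
    heightWeight p (h + 1) (node (n + 1) f) = p (n + 1) * ∏ i, heightWeight p h (f i) := by
  by_cases hf : ∀ i, LeafHeightGE h (f i)
  · have hn : LeafHeightGE (h + 1) (node (n + 1) f) := ⟨n.succ_ne_zero, hf⟩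
    rw [heightWeight, if_pos hn, wordWeight_node]
    congr 1
    exact Finset.prod_congr rfl fun i _ => (if_pos (hf i)).symm
  · have hn : ¬ LeafHeightGE (h + 1) (node (n + 1) f) := fun hn => hf hn.2
    rw [heightWeight, if_neg hn]
    push Not at hf
    obtain ⟨i, hi⟩ := hf
    rw [Finset.prod_eq_zero (Finset.mem_univ i) (if_neg hi), mul_zero]

/-- The probability that the tree is finite and its root has leaf-height at least `h`. -/
noncomputable def heightProb (p : PMF ℕ) (h : ℕ) : ℝ≥0∞ := ∑' t, heightWeight p h t

/-- The probability that the tree has `m` nodes and its root has leaf-height at least `h`. -/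
noncomputable def heightCardProb (p : PMF ℕ) (h m : ℕ) : ℝ≥0∞ :=
  ∑' t : PlaneTree, if t.card = m then heightWeight p h t else 0

lemma heightProb_zero_le (p : PMF ℕ) : heightProb p 0 ≤ 1 := by
  simpa only [heightProb, heightWeight_zero] using tsum_wordWeight_le_one p

lemma tsum_nat (F : ℕ → ℝ≥0∞) : ∑' n, F n = F 0 + ∑' n, F (n + 1) :=
  tsum_eq_zero_add' ENNReal.summable

lemma heightProb_succ (p : PMF ℕ) (h : ℕ) :
    heightProb p (h + 1) = ∑' n : ℕ, p (n + 1) * heightProb p h ^ (n + 1) := by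
  rw [heightProb, tsum_tree, tsum_nat]
  simp only [heightWeight_node_zero, tsum_zero, zero_add, heightWeight_node_succ]
  refine tsum_congr fun n => ?_
  rw [ENNReal.tsum_mul_left, tsum_pi_prod]
  rfl

lemma tsum_succ_eq (p : PMF ℕ) : ∑' n : ℕ, p (n + 1) = 1 - p 0 := by
  rw [← p.tsum_coe, tsum_nat (fun n => p n), ENNReal.add_sub_cancel_left (p.apply_ne_top 0)]

/-- Crude a priori decay, along one child per generation; it makes the errors a_j in ∏ (p 1 + a_j)
summable. -/
lemma heightProb_le_pow (p : PMF ℕ) (h : ℕ) : heightProb p h ≤ (1 - p 0) ^ h := by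
  induction h with
  | zero => simpa using heightProb_zero_le p
  | succ h ih =>
    have h1 : heightProb p h ≤ 1 := ih.trans (pow_le_one₀ zero_le tsub_le_self)
    rw [heightProb_succ, pow_succ']
    refine le_trans ?_ (mul_le_mul_right ih _)
    rw [← tsum_succ_eq, ← ENNReal.tsum_mul_right]
    refine ENNReal.tsum_le_tsum fun n => ?_
    rw [pow_succ']
    exact mul_le_mul_right (mul_le_of_le_one_right' (pow_le_one₀ zero_le h1)) _

lemma heightProb_le_one (p : PMF ℕ) (h : ℕ) : heightProb p h ≤ 1 :=
  (heightProb_le_pow p h).trans (pow_le_one₀ zero_le tsub_le_self)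

/-- A root with one child contributes the factor `p 1`; with two or more children, at least two
independent subtrees must be high. -/
lemma heightProb_succ_le (p : PMF ℕ) (h : ℕ) :
    heightProb p (h + 1) ≤ (p 1 + heightProb p h) * heightProb p h := by
  have h1 := heightProb_le_one p h
  rw [heightProb_succ, tsum_nat, add_mul, zero_add, pow_one]
  refine add_le_add le_rfl ?_
  calc _ ≤ ∑' n : ℕ, p (n + 2) * (heightProb p h * heightProb p h) := by
        refine ENNReal.tsum_le_tsum fun n => mul_le_mul_right ?_ _
        rw [pow_succ', pow_succ']
        exact mul_le_mul_right (mul_le_of_le_one_right' (pow_le_one₀ zero_le h1)) _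
    _ ≤ 1 * (heightProb p h * heightProb p h) := by
        rw [ENNReal.tsum_mul_right]
        refine mul_le_mul_left ?_ _
        rw [← p.tsum_coe]
        exact ENNReal.tsum_comp_le_tsum_of_injective (f := fun n => n + 2)
          (add_left_injective 2) p
    _ = _ := one_mul _

/-- Expand m as the sum of the sizes of the n + 1 trees. In the j-th term fix the other n trees,
apply `hB` to tree j, and sum freely over the others. -/
lemma mul_tsum_card_eq_le {G : PlaneTree → ℝ≥0∞} {B : ℝ≥0∞}
    (hB : ∀ m : ℕ, m * (∑' t : PlaneTree, if t.card = m then G t else 0) ≤ B) (n m : ℕ) :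
    m * (∑' f : Fin (n + 1) → PlaneTree, if ∑ i, (f i).card = m then ∏ i, G (f i) else 0) ≤
      (n + 1) * (∑' t, G t) ^ n * B := by
  have h1 : ∀ j : Fin (n + 1), (∑' f : Fin (n + 1) → PlaneTree,
      ((f j).card : ℝ≥0∞) * if ∑ i, (f i).card = m then ∏ i, G (f i) else 0) ≤
        (∑' t, G t) ^ n * B := by
    intro j
    rw [← (Fin.insertNthEquiv (fun _ => PlaneTree) j).tsum_eq, ENNReal.tsum_prod',
      ENNReal.tsum_comm, ← tsum_pi_prod, ← ENNReal.tsum_mul_right]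
    refine ENNReal.tsum_le_tsum fun f => ?_
    simp only [Fin.insertNthEquiv, Equiv.coe_fn_mk, Fin.insertNth_apply_same,
      Fin.sum_univ_succAbove _ j, Fin.insertNth_apply_succAbove, Fin.prod_univ_succAbove _ j]
    refine le_trans ?_ (mul_le_mul_right (hB (m - ∑ i, (f i).card)) _)
    rw [← ENNReal.tsum_mul_left, ← ENNReal.tsum_mul_left]
    refine ENNReal.tsum_le_tsum fun t => ?_
    split_ifs with h2 h3 h3
    · rw [show t.card = m - ∑ i, (f i).card by omega]
      exact le_of_eq (by ring)
    · omega
    · simp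
    · simp
  calc _ = ∑' f : Fin (n + 1) → PlaneTree, ∑ j,
        ((f j).card : ℝ≥0∞) * if ∑ i, (f i).card = m then ∏ i, G (f i) else 0 := by
        rw [← ENNReal.tsum_mul_left]
        refine tsum_congr fun f => ?_
        rw [← Finset.sum_mul]
        split_ifs with h
        · rw [← h]; push_cast; rfl
        · simp
    _ = ∑ j, ∑' f : Fin (n + 1) → PlaneTree,
        ((f j).card : ℝ≥0∞) * if ∑ i, (f i).card = m then ∏ i, G (f i) else 0 :=
        Summable.tsum_finsetSum fun _ _ => ENNReal.summable
    _ ≤ ∑ j : Fin (n + 1), (∑' t, G t) ^ n * B := Finset.sum_le_sum fun j _ => h1 j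
    _ = _ := by simp [mul_assoc]

/-- The number of children enters as a size-biasing factor, summable by mean 1; each term with at
least two children keeps a spare factor `heightProb p h`. -/
lemma mul_heightCardProb_succ_le {p : PMF ℕ} (hmean : ∑' n : ℕ, p n * n = 1) {h : ℕ} {B : ℝ≥0∞}
    (hB : ∀ m : ℕ, m * heightCardProb p h m ≤ B) (m : ℕ) :
    m * heightCardProb p (h + 1) (m + 1) ≤ (p 1 + heightProb p h) * B := by
  have h1 := heightProb_le_one p h
  have hsum : ∑' n : ℕ, p (n + 1) * (n + 1) * heightProb p h ^ n ≤ p 1 + heightProb p h := by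
    rw [tsum_nat]
    simp only [zero_add, Nat.cast_zero, mul_one, pow_zero]
    refine add_le_add le_rfl ?_
    calc _ ≤ ∑' n : ℕ, (p (n + 2) * (n + 2 : ℕ)) * heightProb p h := by
          refine ENNReal.tsum_le_tsum fun n => ?_
          rw [pow_succ']
          refine mul_le_mul' (le_of_eq ?_) (mul_le_of_le_one_right' (pow_le_one₀ zero_le h1))
          push_cast
          rw [add_assoc (n : ℝ≥0∞), one_add_one_eq_two]
      _ ≤ 1 * heightProb p h := by
          rw [ENNReal.tsum_mul_right, ← hmean]
          refine mul_le_mul_left ?_ _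
          exact ENNReal.tsum_comp_le_tsum_of_injective (f := fun n => n + 2)
            (add_left_injective 2) (fun n : ℕ => p n * n)
      _ = _ := one_mul _
  refine le_trans ?_ (mul_le_mul_left hsum B)
  rw [heightCardProb, tsum_tree, tsum_nat]
  simp only [heightWeight_node_zero, ite_self, tsum_zero, zero_add, heightWeight_node_succ,
    card_node, add_left_inj]
  rw [← ENNReal.tsum_mul_left, ← ENNReal.tsum_mul_right]
  refine ENNReal.tsum_le_tsum fun n => ?_
  have := mul_tsum_card_eq_le (G := heightWeight p h) hB n m
  calc _ = p (n + 1) * (m * (∑' f : Fin (n + 1) → PlaneTree,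
        if ∑ i, (f i).card = m then ∏ i, heightWeight p h (f i) else 0)) := by
        simp only [← ENNReal.tsum_mul_left]
        refine tsum_congr fun f => ?_
        split_ifs <;> ring
    _ ≤ p (n + 1) * ((n + 1) * (∑' t, heightWeight p h t) ^ n * B) := mul_le_mul_right this _
    _ = _ := by rw [heightProb]; ring

lemma heightCardProb_eq_zero (p : PMF ℕ) {h m : ℕ} (hm : m ≤ h) : heightCardProb p h m = 0 := by
  rw [heightCardProb, ENNReal.tsum_eq_zero]
  intro t
  split_ifs with h1
  · rw [heightWeight, if_neg]
    intro h2
    have := h2.lt_length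
    simp only [PlaneTree.card] at h1
    omega
  · rfl

/-! ### Total size through the cycle lemma. -/

/-- The probability that the tree has `n` nodes. -/
noncomputable def cardProb (p : PMF ℕ) (n : ℕ) : ℝ≥0∞ :=
  ∑' t : PlaneTree, if t.card = n then wordWeight p t.word else 0

lemma heightCardProb_zero (p : PMF ℕ) (n : ℕ) : heightCardProb p 0 n = cardProb p n := by
  simp only [heightCardProb, heightWeight_zero, cardProb]

lemma mul_cardProb_eq (p : PMF ℕ) (n : ℕ) : n * cardProb p n =
    ∑' q : PlaneTree × Fin n, if q.1.card = n then wordWeight p q.1.word else 0 := by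
  rw [ENNReal.tsum_prod', cardProb, ← ENNReal.tsum_mul_left]
  refine tsum_congr fun t => ?_
  simp

/-- The n rotations of the words of trees of size n are pairwise distinct words of sum n - 1 with
unchanged weight. -/
lemma mul_cardProb_le_sumProb (p : PMF ℕ) (n : ℕ) : n * cardProb p n ≤ sumProb p n (n - 1) := by
  rw [mul_cardProb_eq]
  refine tsum_ite_le_tsum (S := fun q : PlaneTree × Fin n => q.1.card = n)
    (F := fun q => wordWeight p q.1.word)
    (fun q l => l = q.1.word.rotate q.2) (fun q hq => ⟨_, rfl, ?_⟩) ?_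
  · have h1 := sum_word_add_one q.1
    have h2 := (q.1.word.rotate_perm q.2)
    simp only [PlaneTree.card] at hq
    rw [if_pos ⟨by simpa using hq, by rw [h2.sum_eq]; omega⟩, wordWeight_perm p h2]
  · rintro ⟨t, i⟩ ⟨t', i'⟩ l ht ht' rfl h2
    simp only [PlaneTree.card] at ht ht' h2
    obtain ⟨rfl, h3⟩ := word_rotate_inj (by have := i.2; omega) (by have := i'.2; omega) h2
    rw [Fin.ext h3]

lemma sumProb_le_mul_cardProb (p : PMF ℕ) {n : ℕ} (hn : 0 < n) :
    sumProb p n (n - 1) ≤ n * cardProb p n := by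
  rw [mul_cardProb_eq, sumProb]
  refine tsum_ite_le_tsum (S := fun l : List ℕ => l.length = n ∧ l.sum = n - 1)
    (fun (l : List ℕ) (q : PlaneTree × Fin n) => l = q.1.word.rotate q.2) (fun l hl => ?_) ?_
  · obtain ⟨t, i, hi, rfl⟩ := exists_rotate_eq_word (l := l) (by omega)
    have h2 := (t.word.rotate_perm i)
    have h3 : t.word.length = n := by rw [← hl.1, h2.length_eq]
    exact ⟨(t, ⟨i, by omega⟩), rfl, by simp [show t.card = n from h3, wordWeight_perm p h2]⟩
  · rintro l l' q - - rfl rfl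
    rfl

/-! ### Sharp exponential order of the root leaf-height. -/

/-- An upper bound for the probability of leaf-height at least `h`, of order `p 1 ^ h`. -/
noncomputable def heightBound (p : PMF ℕ) (h : ℕ) : ℝ≥0∞ :=
  ∏ j ∈ Finset.range h, (p 1 + heightProb p j)

lemma heightProb_le_heightBound (p : PMF ℕ) (h : ℕ) : heightProb p h ≤ heightBound p h := by
  induction h with
  | zero => simpa [heightBound] using heightProb_zero_le p
  | succ h ih =>
    rw [heightBound, Finset.prod_range_succ, mul_comm]
    exact (heightProb_succ_le p h).trans (mul_le_mul_right ih _)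

lemma mul_heightCardProb_le {p : PMF ℕ} (hmean : ∑' n : ℕ, p n * n = 1) (h m : ℕ) :
    m * heightCardProb p h m ≤ (h + 1) * heightBound p h := by
  induction h generalizing m with
  | zero =>
    rw [heightCardProb_zero]
    simpa [heightBound] using (mul_cardProb_le_sumProb p m).trans (sumProb_le_one p m (m - 1))
  | succ h ih =>
    rcases le_or_gt m (h + 1) with hm | hm
    · simp [heightCardProb_eq_zero p hm]
    obtain ⟨m, rfl⟩ := Nat.exists_eq_succ_of_ne_zero (by omega : m ≠ 0)
    have h1 := mul_heightCardProb_succ_le hmean ih m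
    -- Deleting the root replaces m + 1 by m. Since m ≥ h + 1 the loss (m + 1)/m is at most (h +
    -- 2)/(h + 1); these ratios telescope to the linear factor in the bound.
    have h2 : ((h + 1 : ℕ) : ℝ≥0∞) * ((m + 1 : ℕ) * heightCardProb p (h + 1) (m + 1)) ≤
        (h + 1 : ℕ) * (((h + 1 : ℕ) + 1) * heightBound p (h + 1)) := by
      calc _ = (((h + 1) * (m + 1) : ℕ) : ℝ≥0∞) * heightCardProb p (h + 1) (m + 1) := by
            push_cast; ring
        _ ≤ (((h + 2) * m : ℕ) : ℝ≥0∞) * heightCardProb p (h + 1) (m + 1) := by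
            refine mul_le_mul_left ?_ _
            norm_cast
            have : h + 1 ≤ m := by omega
            nlinarith
        _ = (h + 2 : ℕ) * (m * heightCardProb p (h + 1) (m + 1)) := by push_cast; ring
        _ ≤ (h + 2 : ℕ) * ((p 1 + heightProb p h) * ((h + 1) * heightBound p h)) :=
            mul_le_mul_right h1 _
        _ = _ := by
            rw [heightBound, heightBound, Finset.prod_range_succ]; push_cast; ring
    exact (ENNReal.mul_le_mul_iff_right (by simp) (ENNReal.natCast_ne_top _)).mp h2

lemma exists_heightBound_le {p : PMF ℕ} (h0 : p 0 ≠ 0) (h1 : p 1 ≠ 0) :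
    ∃ K : ℝ, 0 < K ∧ ∀ h, (heightBound p h).toReal ≤ K * (p 1).toReal ^ h := by
  set b := (p 1).toReal with hb
  have hb0 : 0 < b := ENNReal.toReal_pos h1 (p.apply_ne_top 1)
  have ha0 : 0 < (p 0).toReal := ENNReal.toReal_pos h0 (p.apply_ne_top 0)
  set r := 1 - (p 0).toReal with hr
  have hr0 : 0 ≤ r := by
    have := sum_toReal_le_one p
    rw [hr]; linarith
  have hr1 : r < 1 := by rw [hr]; linarith
  have ha : ∀ j, (heightProb p j).toReal ≤ r ^ j := by
    intro j
    have := ENNReal.toReal_mono (by finiteness) (heightProb_le_pow p j)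
    rwa [ENNReal.toReal_pow, ENNReal.toReal_sub_of_le (p.coe_le_one 0) ENNReal.one_ne_top,
      ENNReal.toReal_one] at this
  -- Each factor satisfies b + r^j ≤ b exp(r^j / b), and Σ r^j = 1/(1 - r).
  refine ⟨Real.exp ((1 - r)⁻¹ / b), Real.exp_pos _, fun h => ?_⟩
  have hfin : ∀ j, heightProb p j ≠ ∞ := fun j =>
    ((heightProb_le_one p j).trans_lt ENNReal.one_lt_top).ne
  rw [heightBound, ENNReal.toReal_prod]
  calc ∏ j ∈ Finset.range h, (p 1 + heightProb p j).toReal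
      ≤ ∏ j ∈ Finset.range h, (b * Real.exp (r ^ j / b)) := by
        refine Finset.prod_le_prod (fun _ _ => ENNReal.toReal_nonneg) fun j _ => ?_
        rw [ENNReal.toReal_add (p.apply_ne_top 1) (hfin j)]
        have h2 := Real.add_one_le_exp (r ^ j / b)
        have h3 := mul_le_mul_of_nonneg_left h2 hb0.le
        rw [mul_add, mul_div_cancel₀ _ hb0.ne', mul_one] at h3
        linarith [ha j]
    _ = Real.exp ((∑ j ∈ Finset.range h, r ^ j) / b) * b ^ h := by
        rw [Finset.prod_mul_distrib, ← Real.exp_sum, Finset.prod_const, Finset.card_range,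
          Finset.sum_div, mul_comm]
    _ ≤ _ := by
        gcongr
        rw [← tsum_geometric_of_lt_one hr0 hr1]
        exact (summable_geometric_of_lt_one hr0 hr1).sum_le_tsum _ fun _ _ => by positivity

/-! ### Upper bound: some node of large leaf-height. -/

open scoped Classical in
/-- The probability that the tree has `n` nodes, one of which has leaf-height at least `h`. -/
noncomputable def highProb (p : PMF ℕ) (h n : ℕ) : ℝ≥0∞ :=
  ∑' t : PlaneTree, if t.card = n ∧ ∃ s : PlaneTree, s.IsSubtree t ∧ LeafHeightGE h s
    then wordWeight p t.word else 0

/-- Writing the word as x s y, map the tree to the pair (s, y x). The word s y x is a rotation of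
the original, so cycle-lemma uniqueness recovers the tree; y x has drift 0. -/
lemma highProb_le_sum (p : PMF ℕ) (h n : ℕ) : highProb p h n ≤
    ∑ m ∈ Finset.range (n + 1), heightCardProb p h m * sumProb p (n - m) (n - m) := by
  have h1 : highProb p h n ≤ ∑' q : PlaneTree × List ℕ,
      if q.1.card + q.2.length = n ∧ q.2.sum = q.2.length then
        heightWeight p h q.1 * wordWeight p q.2 else 0 := by
    classical
    refine (le_of_eq ?_).trans (tsum_ite_le_tsum
      (S := fun t : PlaneTree => t.card = n ∧ ∃ s : PlaneTree, s.IsSubtree t ∧ LeafHeightGE h s)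
      (F := fun t => wordWeight p t.word)
      (fun t (q : PlaneTree × List ℕ) => ∃ i < t.word.length, q.1.word ++ q.2 = t.word.rotate i)
      (fun t ht => ?_) ?_)
    · exact tsum_congr fun t => by congr
    · obtain ⟨hn, s, hs, hh⟩ := ht
      obtain ⟨x, y, hxy⟩ := hs.exists_word_eq
      have hl := congrArg List.length hxy
      have hsum := congrArg List.sum hxy
      simp only [List.length_append, List.sum_append] at hl hsum
      have e1 := sum_word_add_one s
      have e2 := sum_word_add_one t
      have e3 := length_word_pos s
      simp only [PlaneTree.card] at hn
      refine ⟨(s, y ++ x), ⟨x.length, by omega, ?_⟩, ?_⟩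
      · rw [hxy, List.append_assoc, List.rotate_append_length_eq, List.append_assoc]
      · have hc : s.card + (y ++ x).length = n ∧ (y ++ x).sum = (y ++ x).length := by
          simp only [PlaneTree.card, List.length_append, List.sum_append]
          omega
        refine le_of_le_of_eq (le_of_eq ?_) (if_pos hc).symm
        rw [heightWeight, if_pos hh, hxy]
        simp only [wordWeight_append]
        ring
    · rintro t t' q - - ⟨i, hi, h1⟩ ⟨i', hi', h2⟩
      exact (word_rotate_inj hi hi' (h1.symm.trans h2)).1
  refine h1.trans ?_
  rw [ENNReal.tsum_prod']
  simp only [heightCardProb, ← ENNReal.tsum_mul_right]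
  rw [← Summable.tsum_finsetSum fun _ _ => ENNReal.summable]
  refine ENNReal.tsum_le_tsum fun s => ?_
  by_cases hs : s.card ≤ n
  · refine le_trans ?_ (Finset.single_le_sum (fun _ _ => zero_le)
      (Finset.mem_range.mpr (Nat.lt_succ_of_le hs)))
    rw [if_pos rfl, sumProb, ← ENNReal.tsum_mul_left]
    refine ENNReal.tsum_le_tsum fun z => ?_
    split_ifs with h2 h3 h3
    · rfl
    · omega
    · exact zero_le
    · exact zero_le
  · rw [ENNReal.tsum_eq_zero.mpr]
    · exact zero_le
    · intro z
      rw [if_neg (by omega)]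

lemma sum_heightCardProb_le (p : PMF ℕ) (h n : ℕ) :
    ∑ m ∈ Finset.range n, heightCardProb p h m ≤ heightProb p h := by
  simp only [heightCardProb]
  rw [← Summable.tsum_finsetSum fun _ _ => ENNReal.summable]
  refine ENNReal.tsum_le_tsum fun t => ?_
  rw [Finset.sum_ite_eq]
  split_ifs
  · rfl
  · exact zero_le

lemma heightCardProb_le_heightProb (p : PMF ℕ) (h m : ℕ) :
    heightCardProb p h m ≤ heightProb p h :=
  (Finset.single_le_sum (f := heightCardProb p h) (fun _ _ => zero_le)
    (Finset.self_mem_range_succ m)).trans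
    (sum_heightCardProb_le p h (m + 1))

lemma heightProb_ne_top (p : PMF ℕ) (h : ℕ) : heightProb p h ≠ ∞ :=
  ((heightProb_le_one p h).trans_lt ENNReal.one_lt_top).ne

lemma heightCardProb_ne_top (p : PMF ℕ) (h m : ℕ) : heightCardProb p h m ≠ ∞ :=
  ((heightCardProb_le_heightProb p h m).trans_lt (heightProb_ne_top p h).lt_top).ne

lemma sumProb_ne_top (p : PMF ℕ) (n k : ℕ) : sumProb p n k ≠ ∞ :=
  ((sumProb_le_one p n k).trans_lt ENNReal.one_lt_top).ne

lemma heightBound_ne_top (p : PMF ℕ) (h : ℕ) : heightBound p h ≠ ∞ :=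
  ENNReal.prod_ne_top fun j _ => ENNReal.add_ne_top.mpr ⟨p.apply_ne_top 1, heightProb_ne_top p j⟩

lemma sum_inv_sqrt_le (n : ℕ) : ∑ j ∈ Finset.range n, 1 / √((j : ℝ) + 1) ≤ 2 * √n := by
  induction n with
  | zero => simp
  | succ n ih =>
    rw [Finset.sum_range_succ]
    have h1 : (0 : ℝ) < √((n : ℝ) + 1) := by positivity
    have h2 : 1 / √((n : ℝ) + 1) ≤ 2 * √((n : ℝ) + 1) - 2 * √n := by
      rw [div_le_iff₀ h1]
      have e1 := Real.mul_self_sqrt (by positivity : (0 : ℝ) ≤ (n : ℝ) + 1)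
      have e2 := Real.mul_self_sqrt (by positivity : (0 : ℝ) ≤ (n : ℝ))
      nlinarith [sq_nonneg (√((n : ℝ) + 1) - √n)]
    push_cast
    linarith

lemma exists_highProb_le {p : PMF ℕ} (h0 : p 0 ≠ 0) (h1 : p 1 ≠ 0)
    (hmean : ∑' n : ℕ, p n * n = 1) :
    ∃ C : ℝ, 0 < C ∧ ∀ n h : ℕ, 0 < n →
      (highProb p h n).toReal ≤ C * (h + 1) * (p 1).toReal ^ h / √n := by
  obtain ⟨C, hC, hU⟩ := exists_sumProb_le h0 h1
  obtain ⟨K, hK, hb⟩ := exists_heightBound_le h0 h1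
  -- 10 = 2 + 2 · 4: the first term is the range m ≤ n/2, the second the range m > n/2, where the
  -- inverse square roots sum to at most 4√n.
  refine ⟨10 * C * K, by positivity, fun n h hn => ?_⟩
  have hn' : (1 : ℝ) ≤ n := by exact_mod_cast hn
  set B := K * (p 1).toReal ^ h with hB
  have hB0 : 0 ≤ B := by positivity
  have hfin : ∀ m, heightCardProb p h m * sumProb p (n - m) (n - m) ≠ ∞ := fun m =>
    ENNReal.mul_ne_top (heightCardProb_ne_top p h m) (sumProb_ne_top p _ _)
  have hle := ENNReal.toReal_mono (ENNReal.sum_ne_top.mpr fun m _ => hfin m) (highProb_le_sum p h n)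
  rw [ENNReal.toReal_sum fun m _ => hfin m] at hle
  have hsq : (0 : ℝ) < √n := by positivity
  have hterm : ∀ m ∈ Finset.range (n + 1),
      (heightCardProb p h m * sumProb p (n - m) (n - m)).toReal ≤
        2 * C / √n * (heightCardProb p h m).toReal +
          2 * (h + 1) * B * C / n * (1 / √(((n - m : ℕ) : ℝ) + 1)) := by
    intro m hm
    rw [Finset.mem_range] at hm
    have hg0 : 0 ≤ (heightCardProb p h m).toReal := ENNReal.toReal_nonneg
    have hu := hU (n - m) (n - m)
    rw [ENNReal.toReal_mul]
    have hd : (0 : ℝ) < √(((n - m : ℕ) : ℝ) + 1) := by positivity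
    -- Small subtree: the remaining sum is long and supplies n^(-1/2). Large subtree: the joint
    -- bound on size and leaf-height supplies 1/n.
    rcases le_or_gt (2 * m) n with h2 | h2
    · have h3 : C / √(((n - m : ℕ) : ℝ) + 1) ≤ 2 * C / √n := by
        rw [div_le_div_iff₀ hd hsq, mul_comm (2 : ℝ) C, mul_assoc]
        refine mul_le_mul_of_nonneg_left ?_ hC.le
        rw [Real.sqrt_le_left (by positivity), mul_pow, Real.sq_sqrt (by positivity)]
        have : (n : ℝ) ≤ 2 * (n - m : ℕ) := by exact_mod_cast (by omega : n ≤ 2 * (n - m))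
        linarith
      have h4 := mul_le_mul_of_nonneg_left (hu.trans h3) hg0
      have h5 : 0 ≤ 2 * (h + 1) * B * C / n * (1 / √(((n - m : ℕ) : ℝ) + 1)) := by positivity
      linarith
    · have h3 := ENNReal.toReal_mono (ENNReal.mul_ne_top (by finiteness) (heightBound_ne_top p h))
        (mul_heightCardProb_le hmean h m)
      rw [ENNReal.toReal_mul, ENNReal.toReal_mul, ENNReal.toReal_add (by simp) (by simp),
        ENNReal.toReal_natCast, ENNReal.toReal_natCast, ENNReal.toReal_one] at h3
      have h4 : (n : ℝ) ≤ 2 * m := by exact_mod_cast h2.le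
      have h5 : (heightCardProb p h m).toReal ≤ 2 * (h + 1) * B / n := by
        rw [le_div_iff₀ (by positivity)]
        have h6 := mul_le_mul_of_nonneg_left (hb h) (by positivity : (0 : ℝ) ≤ h + 1)
        nlinarith
      have h6 := mul_le_mul h5 hu ENNReal.toReal_nonneg (by positivity)
      have h7 : 0 ≤ 2 * C / √n * (heightCardProb p h m).toReal := by positivity
      calc _ ≤ _ := h6
        _ = 2 * (h + 1) * B * C / n * (1 / √(((n - m : ℕ) : ℝ) + 1)) := by ring
        _ ≤ _ := by linarith
  have hS1 : ∑ m ∈ Finset.range (n + 1), (heightCardProb p h m).toReal ≤ B := by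
    rw [← ENNReal.toReal_sum fun m _ => heightCardProb_ne_top p h m]
    exact (ENNReal.toReal_mono (heightBound_ne_top p h) ((sum_heightCardProb_le p h _).trans
      (heightProb_le_heightBound p h))).trans (hb h)
  have hS2 : ∑ m ∈ Finset.range (n + 1), 1 / √(((n - m : ℕ) : ℝ) + 1) ≤ 4 * √n := by
    have := Finset.sum_range_reflect (fun j : ℕ => 1 / √((j : ℝ) + 1)) (n + 1)
    simp only [Nat.add_sub_cancel] at this
    rw [this]
    refine (sum_inv_sqrt_le (n + 1)).trans ?_
    have : √((n + 1 : ℕ) : ℝ) ≤ 2 * √n := by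
      rw [Real.sqrt_le_left (by positivity), mul_pow, Real.sq_sqrt (by positivity)]
      push_cast; linarith
    linarith
  have hnn : (n : ℝ) = √n * √n := (Real.mul_self_sqrt (by positivity)).symm
  calc (highProb p h n).toReal ≤ _ := hle
    _ ≤ _ := Finset.sum_le_sum hterm
    _ = 2 * C / √n * ∑ m ∈ Finset.range (n + 1), (heightCardProb p h m).toReal +
        2 * (h + 1) * B * C / n * ∑ m ∈ Finset.range (n + 1), 1 / √(((n - m : ℕ) : ℝ) + 1) := by
        rw [Finset.sum_add_distrib, Finset.mul_sum, Finset.mul_sum]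
    _ ≤ 2 * C / √n * B + 2 * (h + 1) * B * C / n * (4 * √n) := by gcongr
    _ = (2 * C * B + 8 * (h + 1) * B * C) / √n := by
        nth_rewrite 2 [hnn]
        field_simp
        ring
    _ ≤ _ := by
        gcongr
        have : 0 ≤ C * B * h := by positivity
        calc _ ≤ 10 * (C * B * (h + 1)) := by nlinarith
          _ = _ := by rw [hB]; ring

/-! ### Lower bound: runs of ones among independent letters. -/

lemma tsum_length_eq (p : PMF ℕ) (n : ℕ) :
    ∑' l : List ℕ, (if l.length = n then wordWeight p l else 0) = 1 := by
  induction n with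
  | zero => rw [tsum_list]; simp
  | succ n ih =>
    rw [tsum_list]
    simp only [List.length_nil, List.length_cons, wordWeight_cons, add_left_inj]
    rw [if_neg (by simp), zero_add, ← p.tsum_coe]
    refine tsum_congr fun a => (tsum_congr fun l => ?_).trans
      (ENNReal.tsum_mul_left.trans (by rw [ih, mul_one]))
    rw [mul_ite, mul_zero]

lemma wordWeight_replicate (p : PMF ℕ) (h a : ℕ) :
    wordWeight p (List.replicate h a) = p a ^ h := by simp [wordWeight]

lemma tsum_ne_replicate_le (p : PMF ℕ) (h : ℕ) :
    ∑' l : List ℕ, (if l.length = h ∧ l ≠ List.replicate h 1 then wordWeight p l else 0) ≤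
      1 - p 1 ^ h := by
  refine ENNReal.le_sub_of_add_le_right (ENNReal.pow_ne_top (p.apply_ne_top 1)) (le_of_eq ?_)
  have h1 := ENNReal.tsum_eq_add_tsum_ite
    (f := fun l : List ℕ => if l.length = h then wordWeight p l else 0) (List.replicate h 1)
  rw [tsum_length_eq, if_pos List.length_replicate, wordWeight_replicate] at h1
  rw [h1, add_comm]
  congr 1
  refine tsum_congr fun l => ?_
  by_cases h1 : l = List.replicate h 1 <;> simp [h1]

open scoped Classical in
/-- The probability that `n` i.i.d. letters contain no run of `h` consecutive ones. -/
noncomputable def noRunProb (p : PMF ℕ) (h n : ℕ) : ℝ≥0∞ :=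
  ∑' l : List ℕ, if l.length = n ∧ ¬ List.replicate h 1 <:+: l then wordWeight p l else 0

/-- Cut off the first h letters: that block is not all ones, and independently the rest contains no
run. -/
lemma noRunProb_add_le (p : PMF ℕ) (h n : ℕ) :
    noRunProb p h (h + n) ≤ (1 - p 1 ^ h) * noRunProb p h n := by
  classical
  refine le_trans ?_ (mul_le_mul_left (tsum_ne_replicate_le p h) _)
  rw [noRunProb, noRunProb, ← ENNReal.tsum_mul_right]
  simp only [← ENNReal.tsum_mul_left]
  rw [← ENNReal.tsum_prod]
  refine (le_of_eq ?_).trans (tsum_ite_le_tsum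
    (S := fun l : List ℕ => l.length = h + n ∧ ¬ List.replicate h 1 <:+: l)
    (F := wordWeight p) (fun l (q : List ℕ × List ℕ) => l = q.1 ++ q.2) (fun l hl => ?_) ?_)
  · exact tsum_congr fun t => by congr
  · refine ⟨(l.take h, l.drop h), by simp, ?_⟩
    rw [if_pos, if_pos, ← wordWeight_append, List.take_append_drop]
    · exact ⟨by simp [hl.1], fun h1 => hl.2 (h1.trans (List.drop_suffix h l).isInfix)⟩
    · refine ⟨by simp [hl.1], fun h1 => hl.2 ?_⟩
      rw [← h1]
      exact (List.take_prefix h l).isInfix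
  · rintro l l' q - - rfl rfl
    rfl

lemma noRunProb_le_pow (p : PMF ℕ) {h n k : ℕ} (hk : k * h ≤ n) :
    noRunProb p h n ≤ (1 - p 1 ^ h) ^ k := by
  induction k generalizing n with
  | zero =>
    rw [pow_zero, ← tsum_length_eq p n, noRunProb]
    refine ENNReal.tsum_le_tsum fun l => ?_
    split_ifs with h1 h2 h2
    · rfl
    · exact absurd h1.1 h2
    · exact zero_le
    · rfl
  | succ k ih =>
    rw [add_mul, one_mul] at hk
    obtain ⟨m, rfl⟩ := Nat.exists_eq_add_of_le (by omega : h ≤ n)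
    rw [pow_succ']
    exact (noRunProb_add_le p h m).trans (mul_le_mul_right (ih (by omega)) _)

open scoped Classical in
/-- The probability that the tree has `n` nodes, all of leaf-height less than `h`. -/
noncomputable def lowProb (p : PMF ℕ) (h n : ℕ) : ℝ≥0∞ :=
  ∑' t : PlaneTree, if t.card = n ∧ ¬ ∃ s : PlaneTree, s.IsSubtree t ∧ LeafHeightGE h s
    then wordWeight p t.word else 0

lemma lowProb_le_noRunProb (p : PMF ℕ) (h n : ℕ) : lowProb p h n ≤ noRunProb p h n := by
  classical
  refine (le_of_eq ?_).trans (tsum_ite_le_tsum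
    (S := fun t : PlaneTree => t.card = n ∧ ¬ ∃ s : PlaneTree, s.IsSubtree t ∧ LeafHeightGE h s)
    (F := fun t => wordWeight p t.word) (fun t l => l = t.word) (fun t ht => ⟨_, rfl, ?_⟩) ?_)
  · exact tsum_congr fun t => by congr
  · rw [if_pos]
    exact ⟨ht.1, fun h1 => ht.2 (exists_isSubtree_leafHeightGE h1)⟩
  · rintro t t' l - - rfl h1
    exact word_injective h1

/-! ### From Ulam–Harris coding to plane trees. -/

/-- `t.Codes k`: the function `k` codes the finite tree `t` in Ulam–Harris coding. -/
def PlaneTree.Codes : PlaneTree → (List ℕ → ℕ) → Prop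
  | node n f, k => k [] = n ∧ ∀ i : Fin n, Codes (f i) fun v => k (i.1 :: v)

/-- The Ulam–Harris addresses of the nodes. -/
def PlaneTree.addresses : PlaneTree → Finset (List ℕ)
  | node _ f => insert [] (Finset.univ.biUnion fun i =>
      (addresses (f i)).map ⟨List.cons i.1, List.cons_injective⟩)

/-- The number of children of the node with a given address. -/
def PlaneTree.degree : PlaneTree → List ℕ → ℕ
  | node n _, [] => n
  | node n f, i :: w => if h : i < n then degree (f ⟨i, h⟩) w else 0

lemma nil_mem_nodes (k : List ℕ → ℕ) : [] ∈ nodes k := by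
  intro v i h
  simp at h

lemma cons_mem_nodes {k : List ℕ → ℕ} {i : ℕ} {w : List ℕ} :
    i :: w ∈ nodes k ↔ i < k [] ∧ w ∈ nodes fun v => k (i :: v) := by
  refine ⟨fun h => ⟨h [] i (by simp), fun v j hv => h (i :: v) j (by simpa using hv)⟩, ?_⟩
  rintro ⟨h1, h2⟩ v j hv
  cases v with
  | nil =>
    simp at hv
    rwa [hv]
  | cons a v =>
    simp only [List.cons_append, List.cons_prefix_cons] at hv
    obtain ⟨rfl, hv⟩ := hv
    exact h2 v j hv

lemma nil_mem_leaves {k : List ℕ → ℕ} : [] ∈ leaves k ↔ k [] = 0 :=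
  ⟨fun h => h.2, fun h => ⟨nil_mem_nodes k, h⟩⟩

lemma cons_mem_leaves {k : List ℕ → ℕ} {i : ℕ} {w : List ℕ} :
    i :: w ∈ leaves k ↔ i < k [] ∧ w ∈ leaves fun v => k (i :: v) := by
  change (i :: w ∈ nodes k ∧ _) ↔ _ ∧ (w ∈ nodes _ ∧ _)
  rw [cons_mem_nodes, and_assoc]

lemma append_mem_leaves {k : List ℕ → ℕ} {u w : List ℕ} (hu : u ∈ nodes k) :
    u ++ w ∈ leaves k ↔ w ∈ leaves fun v => k (u ++ v) := by
  induction u generalizing k with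
  | nil => rfl
  | cons i u ih =>
    rw [cons_mem_nodes] at hu
    rw [List.cons_append, cons_mem_leaves, ih hu.2]
    simp [hu.1]

lemma leafHeight_eq_shift {k : List ℕ → ℕ} {u : List ℕ} (hu : u ∈ nodes k) :
    leafHeight k u = leafHeight (fun v => k (u ++ v)) [] := by
  simp only [leafHeight, append_mem_leaves hu, List.nil_append]

lemma mem_addresses_node {n : ℕ} {f : Fin n → PlaneTree} {u : List ℕ} :
    u ∈ (node n f).addresses ↔ u = [] ∨ ∃ i : Fin n, ∃ w ∈ (f i).addresses, i.1 :: w = u := by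
  simp [addresses]

lemma PlaneTree.Codes.mem_addresses_iff {t : PlaneTree} {k : List ℕ → ℕ} (h : t.Codes k)
    {u : List ℕ} : u ∈ t.addresses ↔ u ∈ nodes k := by
  induction t generalizing k u with
  | node n f ih =>
    rw [mem_addresses_node]
    cases u with
    | nil => simp [nil_mem_nodes]
    | cons i u =>
      rw [cons_mem_nodes, h.1]
      constructor
      · rintro (h1 | ⟨j, w, hw, h1⟩)
        · simp at h1
        · simp only [List.cons.injEq] at h1
          obtain ⟨rfl, rfl⟩ := h1
          exact ⟨j.2, (ih j (h.2 j)).mp hw⟩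
      · rintro ⟨hi, hu⟩
        exact .inr ⟨⟨i, hi⟩, u, (ih ⟨i, hi⟩ (h.2 ⟨i, hi⟩)).mpr hu, rfl⟩

/-- Finitely many coordinates of `k` decide whether it codes `t`, so independence applies. -/
lemma codes_iff {t : PlaneTree} {k : List ℕ → ℕ} :
    t.Codes k ↔ ∀ u ∈ t.addresses, k u = t.degree u := by
  induction t generalizing k with
  | node n f ih =>
    simp only [Codes, ih]
    constructor
    · rintro ⟨h1, h2⟩ u hu
      rcases mem_addresses_node.mp hu with rfl | ⟨i, w, hw, rfl⟩
      · exact h1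
      · simpa [degree] using h2 i w hw
    · intro h
      refine ⟨h [] (mem_addresses_node.mpr (.inl rfl)), fun i w hw => ?_⟩
      simpa [degree] using h (i.1 :: w) (mem_addresses_node.mpr (.inr ⟨i, w, hw, rfl⟩))

lemma pairwiseDisjoint_addresses {n : ℕ} (f : Fin n → PlaneTree) :
    ((Finset.univ : Finset (Fin n)) : Set (Fin n)).PairwiseDisjoint fun i =>
      (f i).addresses.map ⟨List.cons i.1, List.cons_injective⟩ := by
  intro i _ j _ hij
  rw [Function.onFun, Finset.disjoint_left]
  simp only [Finset.mem_map, Function.Embedding.coeFn_mk]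
  rintro _ ⟨a, _, rfl⟩ ⟨b, _, h⟩
  simp only [List.cons.injEq] at h
  exact hij (Fin.ext h.1.symm)

lemma prod_addresses_node {M : Type*} [CommMonoid M] {n : ℕ} (f : Fin n → PlaneTree)
    (F : List ℕ → M) : ∏ u ∈ (node n f).addresses, F u =
      F [] * ∏ i : Fin n, ∏ u ∈ (f i).addresses, F (i.1 :: u) := by
  rw [addresses, Finset.prod_insert (by simp),
    Finset.prod_biUnion (pairwiseDisjoint_addresses f)]
  simp

lemma prod_degree (p : PMF ℕ) (t : PlaneTree) :
    ∏ u ∈ t.addresses, p (t.degree u) = wordWeight p t.word := by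
  induction t with
  | node n f ih =>
    rw [prod_addresses_node, wordWeight_node]
    simp [degree, ih]

lemma card_addresses (t : PlaneTree) : t.addresses.card = t.card := by
  induction t with
  | node n f ih =>
    rw [card_node, addresses, Finset.card_insert_of_notMem (by simp),
      Finset.card_biUnion (pairwiseDisjoint_addresses f)]
    simp [ih]

lemma PlaneTree.Codes.nodes_eq {t : PlaneTree} {k : List ℕ → ℕ} (h : t.Codes k) :
    nodes k = t.addresses := by
  ext u; exact h.mem_addresses_iff.symm

lemma PlaneTree.Codes.size_eq {t : PlaneTree} {k : List ℕ → ℕ} (h : t.Codes k) :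
    size k = t.card := by
  rw [size, h.nodes_eq, Set.encard_coe_eq_coe_finsetCard, card_addresses]

lemma PlaneTree.Codes.unique {t t' : PlaneTree} {k : List ℕ → ℕ} (h : t.Codes k)
    (h' : t'.Codes k) : t = t' := by
  induction t generalizing t' k with
  | node n f ih =>
    obtain ⟨m, g⟩ := t'
    obtain ⟨rfl, h2⟩ := h
    obtain ⟨h1, h3⟩ := h'
    subst h1
    rw [funext fun i => ih i (h2 i) (h3 i)]

/-- Strong induction on the number of nodes: the nodes below a child embed in the node set and miss
the root. -/
lemma exists_codes {k : List ℕ → ℕ} (hk : (nodes k).Finite) : ∃ t : PlaneTree, t.Codes k := by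
  induction hN : (nodes k).ncard using Nat.strong_induction_on generalizing k with
  | _ N ih =>
    have h : ∀ i : Fin (k []), ∃ t : PlaneTree, t.Codes fun v => k (i.1 :: v) := by
      intro i
      have hss : List.cons i.1 '' (nodes fun v => k (i.1 :: v)) ⊂ nodes k := by
        refine (Set.ssubset_iff_of_subset ?_).mpr ⟨[], nil_mem_nodes k, by simp⟩
        rintro _ ⟨w, hw, rfl⟩
        exact cons_mem_nodes.mpr ⟨i.2, hw⟩
      have hfin := (hk.subset hss.subset).of_finite_image List.cons_injective.injOn
      refine ih _ ?_ hfin rfl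
      rw [← hN, ← Set.ncard_image_of_injective _ (List.cons_injective (a := i.1))]
      exact Set.ncard_lt_ncard hss hk
    choose f hf using h
    exact ⟨node (k []) f, rfl, hf⟩

lemma PlaneTree.Codes.exists_leaf {t : PlaneTree} {k : List ℕ → ℕ} (h : t.Codes k) :
    ∃ w, w ∈ leaves k := by
  induction t generalizing k with
  | node n f ih =>
    cases n with
    | zero => exact ⟨[], nil_mem_leaves.mpr h.1⟩
    | succ n =>
      obtain ⟨w, hw⟩ := ih 0 (h.2 0)
      exact ⟨0 :: w, cons_mem_leaves.mpr ⟨by simp [h.1], hw⟩⟩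

lemma PlaneTree.Codes.leafHeightGE_iff {t : PlaneTree} {k : List ℕ → ℕ} (h : t.Codes k) {r : ℕ} :
    LeafHeightGE r t ↔ ∀ w ∈ leaves k, r ≤ w.length := by
  induction t generalizing k r with
  | node n f ih =>
    cases r with
    | zero => simp [LeafHeightGE]
    | succ r =>
      constructor
      · rintro ⟨hn, hf⟩ w hw
        cases w with
        | nil => exact absurd (h.1.symm.trans (nil_mem_leaves.mp hw)) hn
        | cons i w =>
          obtain ⟨hi, hw⟩ := cons_mem_leaves.mp hw
          rw [h.1] at hi
          have := (ih ⟨i, hi⟩ (h.2 ⟨i, hi⟩)).mp (hf ⟨i, hi⟩) w hw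
          simpa using this
      · intro hl
        refine ⟨fun hn => ?_, fun i => (ih i (h.2 i)).mpr fun w hw => ?_⟩
        · have := hl [] (nil_mem_leaves.mpr (h.1.trans hn))
          simp at this
        · have := hl (i.1 :: w) (cons_mem_leaves.mpr ⟨by rw [h.1]; exact i.2, hw⟩)
          simpa using this

/-- Existence of a leaf excludes the default value of the infimum of an empty set. -/
lemma PlaneTree.Codes.le_leafHeight_iff {t : PlaneTree} {k : List ℕ → ℕ} (h : t.Codes k) {r : ℕ} :
    r ≤ leafHeight k [] ↔ LeafHeightGE r t := by
  rw [h.leafHeightGE_iff, leafHeight]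
  simp only [List.nil_append]
  obtain ⟨w, hw⟩ := h.exists_leaf
  refine ⟨fun h1 w hw => h1.trans (Nat.sInf_le ⟨w, rfl, hw⟩), fun h1 => ?_⟩
  refine le_csInf ⟨_, w, rfl, hw⟩ ?_
  rintro _ ⟨w, rfl, hw⟩
  exact h1 w hw

lemma PlaneTree.Codes.exists_subtree {t : PlaneTree} {k : List ℕ → ℕ} (h : t.Codes k)
    {u : List ℕ} (hu : u ∈ nodes k) :
    ∃ s : PlaneTree, s.IsSubtree t ∧ s.Codes fun v => k (u ++ v) := by
  induction t generalizing k u with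
  | node n f ih =>
    cases u with
    | nil => exact ⟨_, .refl _, h⟩
    | cons i u =>
      obtain ⟨hi, hu⟩ := cons_mem_nodes.mp hu
      rw [h.1] at hi
      obtain ⟨s, hs, hc⟩ := ih ⟨i, hi⟩ (h.2 ⟨i, hi⟩) hu
      exact ⟨s, .child _ hs, hc⟩

lemma PlaneTree.IsSubtree.exists_address {s t : PlaneTree} (hs : s.IsSubtree t)
    {k : List ℕ → ℕ} (h : t.Codes k) : ∃ u ∈ nodes k, s.Codes fun v => k (u ++ v) := by
  induction hs generalizing k with
  | refl => exact ⟨[], nil_mem_nodes k, h⟩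
  | @child n f i _ ih =>
    obtain ⟨u, hu, hc⟩ := ih (h.2 i)
    exact ⟨i.1 :: u, cons_mem_nodes.mpr ⟨by rw [h.1]; exact i.2, hu⟩, hc⟩

lemma PlaneTree.Codes.le_maxLeafHeight_iff {t : PlaneTree} {k : List ℕ → ℕ} (h : t.Codes k)
    {r : ℕ} : r ≤ maxLeafHeight k ↔ ∃ s : PlaneTree, s.IsSubtree t ∧ LeafHeightGE r s := by
  have hfin : (leafHeight k '' nodes k).Finite := by
    rw [h.nodes_eq]; exact (Finset.finite_toSet _).image _
  constructor
  · intro hr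
    obtain ⟨u, hu, hmax⟩ := Nat.sSup_mem (s := leafHeight k '' nodes k)
      ⟨_, [], nil_mem_nodes k, rfl⟩ hfin.bddAbove
    obtain ⟨s, hs, hc⟩ := h.exists_subtree hu
    refine ⟨s, hs, hc.le_leafHeight_iff.mp ?_⟩
    rwa [← leafHeight_eq_shift hu, hmax]
  · rintro ⟨s, hs, hr⟩
    obtain ⟨u, hu, hc⟩ := hs.exists_address h
    refine (hc.le_leafHeight_iff.mpr hr).trans ?_
    rw [← leafHeight_eq_shift hu]
    exact le_csSup hfin.bddAbove ⟨u, hu, rfl⟩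

/-! ### Probabilities of tree events. -/

section Probability

/-- The event that the random tree equals `t`. -/
def treeEvent {Ω : Type*} (ξ : List ℕ → Ω → ℕ) (t : PlaneTree) : Set Ω := {ω | t.Codes fun u => ξ u ω}

lemma treeEvent_eq {Ω : Type*} (ξ : List ℕ → Ω → ℕ) (t : PlaneTree) :
    treeEvent ξ t = ⋂ u ∈ t.addresses, ξ u ⁻¹' {t.degree u} := by
  ext ω
  simp [treeEvent, codes_iff]

lemma setOf_size_eq {Ω : Type*} (ξ : List ℕ → Ω → ℕ) (n : ℕ) :
    {ω | size (fun u => ξ u ω) = (n : ℕ∞)} =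
      ⋃ t : {t : PlaneTree // t.card = n}, treeEvent ξ t := by
  ext ω
  simp only [Set.mem_ofPred_eq, Set.mem_iUnion]
  constructor
  · intro h
    have hfin : (nodes fun u => ξ u ω).Finite := by
      rw [← Set.encard_ne_top_iff]
      exact fun h1 => ENat.natCast_ne_top n (h.symm.trans h1)
    obtain ⟨t, ht⟩ := exists_codes hfin
    refine ⟨⟨t, ?_⟩, ht⟩
    exact_mod_cast ht.size_eq.symm.trans h
  · rintro ⟨⟨t, rfl⟩, ht⟩
    exact ht.size_eq

variable {Ω : Type*} [MeasurableSpace Ω] {P : Measure Ω} {p : PMF ℕ} {ξ : List ℕ → Ω → ℕ}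

lemma IsOffspringFamily.measurableSet_treeEvent (hξ : IsOffspringFamily P p ξ) (t : PlaneTree) :
    MeasurableSet (treeEvent ξ t) := by
  rw [treeEvent_eq]
  exact Finset.measurableSet_biInter _ fun u _ => hξ.measurable u (measurableSet_singleton _)

lemma IsOffspringFamily.measure_treeEvent (hξ : IsOffspringFamily P p ξ) (t : PlaneTree) :
    P (treeEvent ξ t) = wordWeight p t.word := by
  rw [treeEvent_eq, hξ.indep.measure_inter_preimage_eq_mul _
    fun u _ => measurableSet_singleton _, ← prod_degree]
  refine Finset.prod_congr rfl fun u _ => ?_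
  rw [← Measure.map_apply (hξ.measurable u) (measurableSet_singleton _), hξ.law,
    PMF.toMeasure_apply_singleton _ _ (measurableSet_singleton _)]

lemma IsOffspringFamily.measurableSet_size_eq (hξ : IsOffspringFamily P p ξ) (n : ℕ) :
    MeasurableSet {ω | size (fun u => ξ u ω) = (n : ℕ∞)} := by
  rw [setOf_size_eq]
  exact .iUnion fun t => hξ.measurableSet_treeEvent t

open scoped Classical in
lemma tsum_subtype_eq_ite {α : Type*} (S : α → Prop) (F : α → ℝ≥0∞) :
    ∑' a : {a // S a}, F a = ∑' a, if S a then F a else 0 := by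
  rw [show (∑' a : {a // S a}, F a) = ∑' a : {a | S a}, F a from rfl, tsum_subtype {a | S a} F]
  refine tsum_congr fun a => ?_
  simp [Set.indicator]

lemma IsOffspringFamily.measure_size_eq (hξ : IsOffspringFamily P p ξ) (n : ℕ) :
    P {ω | size (fun u => ξ u ω) = (n : ℕ∞)} = cardProb p n := by
  rw [setOf_size_eq, measure_iUnion (f := fun t : {t : PlaneTree // t.card = n} => treeEvent ξ t) ?_
    fun t => hξ.measurableSet_treeEvent t]
  · simp only [hξ.measure_treeEvent]
    rw [tsum_subtype_eq_ite (fun t : PlaneTree => t.card = n) fun t => wordWeight p t.word,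
      cardProb]
    exact tsum_congr fun t => by congr
  · intro t t' htt
    rw [Function.onFun, Set.disjoint_left]
    exact fun ω h h' => htt (Subtype.ext (h.unique h'))

/-- Countable subadditivity over the possible trees suffices, so `A` need not be measurable. -/
lemma IsOffspringFamily.measure_inter_le (hξ : IsOffspringFamily P p ξ) (n : ℕ)
    (A : Set Ω) (S : PlaneTree → Prop) [DecidablePred S]
    (hA : ∀ ω ∈ A, ∀ t : PlaneTree, t.card = n → t.Codes (fun u => ξ u ω) → S t) :
    P ({ω | size (fun u => ξ u ω) = (n : ℕ∞)} ∩ A) ≤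
      ∑' t : PlaneTree, if t.card = n ∧ S t then wordWeight p t.word else 0 := by
  have h1 : {ω | size (fun u => ξ u ω) = (n : ℕ∞)} ∩ A ⊆
      ⋃ t : {t : PlaneTree // t.card = n ∧ S t}, treeEvent ξ t := by
    rw [setOf_size_eq]
    rintro ω ⟨h, hω⟩
    obtain ⟨⟨t, ht⟩, hc⟩ := Set.mem_iUnion.mp h
    exact Set.mem_iUnion.mpr ⟨⟨t, ht, hA ω hω t ht hc⟩, hc⟩
  refine (measure_mono h1).trans ((measure_iUnion_le _).trans (le_of_eq ?_))
  simp only [hξ.measure_treeEvent]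
  rw [tsum_subtype_eq_ite (fun t : PlaneTree => t.card = n ∧ S t) fun t => wordWeight p t.word]
  exact tsum_congr fun t => by congr

lemma IsOffspringFamily.measure_le_maxLeafHeight (hξ : IsOffspringFamily P p ξ) (h n : ℕ) :
    P ({ω | size (fun u => ξ u ω) = (n : ℕ∞)} ∩ {ω | h ≤ maxLeafHeight fun u => ξ u ω}) ≤
      highProb p h n := by
  classical
  refine (hξ.measure_inter_le n _ (fun t => ∃ s : PlaneTree, s.IsSubtree t ∧ LeafHeightGE h s)
    fun ω hω t _ hc => hc.le_maxLeafHeight_iff.mp hω).trans (le_of_eq ?_)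
  exact tsum_congr fun t => by congr

lemma IsOffspringFamily.measure_maxLeafHeight_lt (hξ : IsOffspringFamily P p ξ) (h n : ℕ) :
    P ({ω | size (fun u => ξ u ω) = (n : ℕ∞)} ∩ {ω | maxLeafHeight (fun u => ξ u ω) < h}) ≤
      lowProb p h n := by
  classical
  refine (hξ.measure_inter_le n _ (fun t => ¬ ∃ s : PlaneTree, s.IsSubtree t ∧ LeafHeightGE h s)
    fun ω hω t _ hc hs => not_le_of_gt hω (hc.le_maxLeafHeight_iff.mpr hs)).trans (le_of_eq ?_)
  exact tsum_congr fun t => by congr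

end Probability

/-! ### Positivity of the conditioning event; finiteness of the weights. -/

/-- The tree with `n + 1` nodes in which every node has at most one child. -/
def pathTree : ℕ → PlaneTree
  | 0 => node 0 Fin.elim0
  | n + 1 => node 1 fun _ => pathTree n

lemma card_pathTree (n : ℕ) : (pathTree n).card = n + 1 := by
  induction n with
  | zero => simp [pathTree, card_node]
  | succ n ih => simp [pathTree, card_node, ih]

lemma wordWeight_pathTree (p : PMF ℕ) (n : ℕ) :
    wordWeight p (pathTree n).word = p 1 ^ n * p 0 := by
  induction n with
  | zero => simp [pathTree, wordWeight_node]
  | succ n ih => simp [pathTree, wordWeight_node, ih, pow_succ']; ring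

lemma cardProb_ne_zero {p : PMF ℕ} (h0 : p 0 ≠ 0) (h1 : p 1 ≠ 0) {n : ℕ} (hn : 1 ≤ n) :
    cardProb p n ≠ 0 := by
  intro h
  rw [cardProb, ENNReal.tsum_eq_zero] at h
  have := h (pathTree (n - 1))
  rw [if_pos (by rw [card_pathTree]; omega), wordWeight_pathTree] at this
  exact mul_ne_zero (pow_ne_zero _ h1) h0 this

lemma tsum_mul_natCast_eq_one {p : PMF ℕ} (hfin : MemLp (fun i : ℕ => (i : ℝ)) 2 p.toMeasure)
    (hmean : ∫ i : ℕ, (i : ℝ) ∂p.toMeasure = 1) : ∑' n : ℕ, p n * n = 1 := by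
  have h := ofReal_integral_eq_lintegral_ofReal (integrable_natCast hfin)
    (ae_of_all _ fun i => Nat.cast_nonneg i)
  rw [hmean, ENNReal.ofReal_one, lintegral_countable'] at h
  rw [h]
  refine tsum_congr fun n => ?_
  rw [PMF.toMeasure_apply_singleton _ _ (measurableSet_singleton n), ENNReal.ofReal_natCast,
    mul_comm]

lemma cardProb_le_one (p : PMF ℕ) (n : ℕ) : cardProb p n ≤ 1 := by
  refine le_trans (ENNReal.tsum_le_tsum fun t => ?_) (tsum_wordWeight_le_one p)
  split_ifs
  · rfl
  · exact zero_le

lemma highProb_le_one (p : PMF ℕ) (h n : ℕ) : highProb p h n ≤ 1 := by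
  refine le_trans (ENNReal.tsum_le_tsum fun t => ?_) (tsum_wordWeight_le_one p)
  split_ifs
  · rfl
  · exact zero_le

lemma lowProb_le_one (p : PMF ℕ) (h n : ℕ) : lowProb p h n ≤ 1 := by
  refine le_trans (ENNReal.tsum_le_tsum fun t => ?_) (tsum_wordWeight_le_one p)
  split_ifs
  · rfl
  · exact zero_le

/-! ### Bounds relative to the probability of size n. -/

section Asymptotics

variable {p : PMF ℕ}

lemma exists_le_cardProb (h0 : p 0 ≠ 0) (h1 : p 1 ≠ 0)
    (hfin : MemLp (fun i : ℕ => (i : ℝ)) 2 p.toMeasure)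
    (hmean : ∫ i : ℕ, (i : ℝ) ∂p.toMeasure = 1)
    (hvar : 0 < variance (fun i : ℕ => (i : ℝ)) p.toMeasure) :
    ∃ c : ℝ, 0 < c ∧ ∀ᶠ n : ℕ in atTop, c / (n * √n) ≤ (cardProb p n).toReal := by
  obtain ⟨c, hc, h⟩ := exists_le_sumProb h0 h1 hfin hmean hvar
  refine ⟨c, hc, ?_⟩
  filter_upwards [h, eventually_gt_atTop 0] with n hn hn0
  have hn' : (0 : ℝ) < n := by exact_mod_cast hn0
  have h2 := ENNReal.toReal_mono (ENNReal.mul_ne_top (ENNReal.natCast_ne_top n)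
    ((cardProb_le_one p n).trans_lt ENNReal.one_lt_top).ne) (sumProb_le_mul_cardProb p hn0)
  rw [ENNReal.toReal_mul, ENNReal.toReal_natCast] at h2
  rw [mul_comm (n : ℝ), ← div_div, div_le_iff₀ hn', mul_comm]
  exact hn.trans h2

lemma exists_highProb_le_mul_cardProb (h0 : p 0 ≠ 0) (h1 : p 1 ≠ 0)
    (hfin : MemLp (fun i : ℕ => (i : ℝ)) 2 p.toMeasure)
    (hmean : ∫ i : ℕ, (i : ℝ) ∂p.toMeasure = 1)
    (hvar : 0 < variance (fun i : ℕ => (i : ℝ)) p.toMeasure) :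
    ∃ C : ℝ, 0 < C ∧ ∀ᶠ n : ℕ in atTop, ∀ h : ℕ, (highProb p h n).toReal ≤
      C * ((h + 1) * ((p 1).toReal ^ h * n)) * (cardProb p n).toReal := by
  obtain ⟨c, hc, hq⟩ := exists_le_cardProb h0 h1 hfin hmean hvar
  obtain ⟨C, hC, hH⟩ := exists_highProb_le h0 h1 (tsum_mul_natCast_eq_one hfin hmean)
  refine ⟨C / c, by positivity, ?_⟩
  filter_upwards [hq, eventually_gt_atTop 0] with n hn hn0 h
  have hn' : (0 : ℝ) < n := by exact_mod_cast hn0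
  have hs : 0 < √(n : ℝ) := by positivity
  refine (hH n h hn0).trans ?_
  calc C * (h + 1) * (p 1).toReal ^ h / √n
      = C / c * ((h + 1) * ((p 1).toReal ^ h * n)) * (c / (n * √n)) := by field_simp
    _ ≤ _ := by gcongr

lemma exists_lowProb_le_mul_cardProb (h0 : p 0 ≠ 0) (h1 : p 1 ≠ 0)
    (hfin : MemLp (fun i : ℕ => (i : ℝ)) 2 p.toMeasure)
    (hmean : ∫ i : ℕ, (i : ℝ) ∂p.toMeasure = 1)
    (hvar : 0 < variance (fun i : ℕ => (i : ℝ)) p.toMeasure) :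
    ∃ C : ℝ, 0 < C ∧ ∀ᶠ n : ℕ in atTop, ∀ h : ℕ, (lowProb p h n).toReal ≤
      C * (n * √n * Real.exp (-((p 1).toReal ^ h * (n / h : ℕ)))) * (cardProb p n).toReal := by
  obtain ⟨c, hc, hq⟩ := exists_le_cardProb h0 h1 hfin hmean hvar
  refine ⟨1 / c, by positivity, ?_⟩
  filter_upwards [hq, eventually_gt_atTop 0] with n hn hn0 h
  have hn' : (0 : ℝ) < n := by exact_mod_cast hn0
  have hs : 0 < √(n : ℝ) := by positivity
  have h2 := ENNReal.toReal_mono (by finiteness)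
    ((lowProb_le_noRunProb p h n).trans (noRunProb_le_pow p (Nat.div_mul_le_self n h)))
  have h3 : p 1 ^ h ≤ 1 := pow_le_one₀ zero_le (p.coe_le_one 1)
  rw [ENNReal.toReal_pow, ENNReal.toReal_sub_of_le h3 ENNReal.one_ne_top, ENNReal.toReal_one,
    ENNReal.toReal_pow] at h2
  have h4 : (p 1).toReal ^ h ≤ 1 := by
    have := ENNReal.toReal_mono ENNReal.one_ne_top h3
    rwa [ENNReal.toReal_pow, ENNReal.toReal_one] at this
  have h5 : (1 - (p 1).toReal ^ h) ^ (n / h) ≤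
      Real.exp (-((p 1).toReal ^ h * (n / h : ℕ))) := by
    refine (pow_le_pow_left₀ (by linarith) (Real.one_sub_le_exp_neg _) _).trans_eq ?_
    rw [← Real.exp_nat_mul]
    ring_nf
  refine (h2.trans h5).trans ?_
  calc Real.exp (-((p 1).toReal ^ h * (n / h : ℕ)))
      = 1 / c * (n * √n * Real.exp (-((p 1).toReal ^ h * (n / h : ℕ)))) * (c / (n * √n)) := by
        field_simp
    _ ≤ _ := by gcongr

end Asymptotics

/-! ### Limits at the two thresholds. -/

section Calculus

lemma tendsto_linear_mul_exp_neg (A B : ℝ) {δ : ℝ} (hδ : 0 < δ) :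
    Tendsto (fun x : ℝ => (A * x + B) * Real.exp (-(δ * x))) atTop (𝓝 0) := by
  have h1 := (isLittleO_pow_exp_pos_mul_atTop (k := 1) hδ).const_mul_left A
  have h2 := (isLittleO_pow_exp_pos_mul_atTop (k := 0) hδ).const_mul_left B
  refine (h1.add h2).tendsto_div_nhds_zero.congr fun x => ?_
  rw [Real.exp_neg, pow_one, pow_zero, mul_one, div_eq_mul_inv]

variable {b : ℝ}

lemma pow_eq_exp (hb0 : 0 < b) (h : ℕ) : b ^ h = Real.exp (-(Real.log (1 / b) * h)) := by
  rw [one_div, Real.log_inv, neg_mul, neg_neg, mul_comm, Real.exp_nat_mul, Real.exp_log hb0]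

lemma tendsto_log_natCast : Tendsto (fun n : ℕ => Real.log n) atTop atTop :=
  Real.tendsto_log_atTop.comp tendsto_natCast_atTop_atTop

lemma tendsto_high (hb0 : 0 < b) (hb1 : b < 1) {ε : ℝ} (hε : 0 < ε) :
    Tendsto (fun n : ℕ => ((⌈(1 / Real.log (1 / b) + ε) * Real.log n⌉₊ : ℝ) + 1) *
      (b ^ ⌈(1 / Real.log (1 / b) + ε) * Real.log n⌉₊ * n)) atTop (𝓝 0) := by
  set ℓ := Real.log (1 / b) with hℓ
  have hℓ0 : 0 < ℓ := Real.log_pos (by rw [lt_div_iff₀ hb0]; linarith)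
  have h := (tendsto_linear_mul_exp_neg (1 / ℓ + ε) 2 (mul_pos hℓ0 hε)).comp tendsto_log_natCast
  refine tendsto_of_tendsto_of_tendsto_of_le_of_le' tendsto_const_nhds h
    (Eventually.of_forall fun n => by positivity) ?_
  filter_upwards [eventually_ge_atTop 1] with n hn
  have hn' : (1 : ℝ) ≤ n := by exact_mod_cast hn
  have hx : 0 ≤ Real.log n := Real.log_nonneg hn'
  have hy : 0 ≤ (1 / ℓ + ε) * Real.log n := by positivity
  set m := ⌈(1 / ℓ + ε) * Real.log n⌉₊
  have h1 : (m : ℝ) ≤ (1 / ℓ + ε) * Real.log n + 1 := (Nat.ceil_lt_add_one hy).le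
  have h2 : (1 / ℓ + ε) * Real.log n ≤ m := Nat.le_ceil _
  have h3 : b ^ m * n ≤ Real.exp (-(ℓ * ε * Real.log n)) := by
    rw [pow_eq_exp hb0, ← Real.exp_log (by linarith : (0 : ℝ) < n), ← Real.exp_add,
      Real.log_exp, Real.exp_le_exp, ← hℓ]
    have := mul_le_mul_of_nonneg_left h2 hℓ0.le
    have e : ℓ * ((1 / ℓ + ε) * Real.log n) = Real.log n + ℓ * ε * Real.log n := by
      field_simp
    linarith
  exact mul_le_mul (by linarith) h3 (by positivity) (by positivity)

lemma eventually_exp_le (hb0 : 0 < b) (κ : ℝ) {δ : ℝ} (hδ : 0 < δ) :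
    ∀ᶠ x : ℝ in atTop, 5 * x * (κ * x + 1) ≤ b * Real.exp (δ * x) := by
  have h1 := (isLittleO_pow_exp_pos_mul_atTop (k := 2) hδ).const_mul_left (5 * κ)
  have h2 := (isLittleO_pow_exp_pos_mul_atTop (k := 1) hδ).const_mul_left 5
  filter_upwards [(h1.add h2).bound hb0] with x hx
  rw [Real.norm_of_nonneg (Real.exp_pos _).le] at hx
  refine le_trans (le_of_eq ?_) ((Real.le_norm_self _).trans hx)
  ring

lemma tendsto_low (hb0 : 0 < b) (hb1 : b < 1) {ε : ℝ} (hε : 0 < ε) :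
    Tendsto (fun n : ℕ => n * √n * Real.exp
      (-(b ^ (⌊(1 / Real.log (1 / b) - ε) * Real.log n⌋₊ + 1) *
        (n / (⌊(1 / Real.log (1 / b) - ε) * Real.log n⌋₊ + 1) : ℕ)))) atTop (𝓝 0) := by
  set ℓ := Real.log (1 / b) with hℓ
  have hℓ0 : 0 < ℓ := Real.log_pos (by rw [lt_div_iff₀ hb0]; linarith)
  -- Truncation at 0 matches the natural floor, which is 0 once ε ≥ 1/ℓ.
  set κ := max (1 / ℓ - ε) 0 with hκ
  have hκ0 : 0 ≤ κ := le_max_right _ _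
  set δ := 1 - ℓ * κ with hδdef
  have hδ : 0 < δ := by
    rcases max_cases (1 / ℓ - ε) 0 with ⟨h, -⟩ | ⟨h, -⟩
    · have : ℓ * κ = 1 - ℓ * ε := by rw [hκ, h]; field_simp
      have := mul_pos hℓ0 hε
      linarith
    · rw [hδdef, hκ, h]; norm_num
  have hlim : Tendsto (fun n : ℕ => Real.exp (-Real.log n)) atTop (𝓝 0) :=
    Real.tendsto_exp_neg_atTop_nhds_zero.comp tendsto_log_natCast
  refine tendsto_of_tendsto_of_tendsto_of_le_of_le' tendsto_const_nhds hlim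
    (Eventually.of_forall fun n => by positivity) ?_
  filter_upwards [eventually_ge_atTop 1, tendsto_log_natCast.eventually (eventually_exp_le hb0 κ hδ),
    -- This instance only serves to get m ≤ n.
    tendsto_log_natCast.eventually (eventually_exp_le zero_lt_one κ zero_lt_one),
    tendsto_log_natCast.eventually (eventually_ge_atTop 1)] with n hn h1 h2 hx
  have hn' : (0 : ℝ) < n := by exact_mod_cast hn
  set x := Real.log n with hxdef
  have hnx : (n : ℝ) = Real.exp x := (Real.exp_log hn').symm
  set m := ⌊(1 / ℓ - ε) * x⌋₊ + 1 with hm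
  have hm1 : (m : ℝ) ≤ κ * x + 1 := by
    rw [hm]
    push_cast
    gcongr
    refine (Nat.cast_le.mpr (Nat.floor_mono (mul_le_mul_of_nonneg_right (le_max_left _ 0)
      (by linarith : (0 : ℝ) ≤ x)))).trans (Nat.floor_le (by positivity))
  have hm0 : (1 : ℝ) ≤ m := by rw [hm]; push_cast; linarith [Nat.cast_nonneg (α := ℝ) ⌊(1 / ℓ - ε) * x⌋₊]
  have hmn : m ≤ n := by
    have : (m : ℝ) ≤ n := by
      rw [hnx]
      rw [one_mul, one_mul] at h2
      nlinarith
    exact_mod_cast this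
  have hdiv : (n : ℝ) / (2 * m) ≤ (n / m : ℕ) := by
    have h3 : 1 ≤ n / m := (Nat.one_le_div_iff (by omega)).mpr hmn
    have h4 := Nat.lt_div_mul_add (a := n) (b := m) (by omega)
    have h5 : n ≤ 2 * m * (n / m) := by nlinarith
    rw [div_le_iff₀ (by positivity)]
    have h6 : (n : ℝ) ≤ 2 * m * (n / m : ℕ) := by exact_mod_cast h5
    linarith
  have hbm : b * Real.exp (-(ℓ * κ * x)) ≤ b ^ m := by
    rw [pow_eq_exp hb0, ← hℓ]
    nth_rewrite 1 [show b = Real.exp (-ℓ) by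
      rw [hℓ, one_div, Real.log_inv, neg_neg, Real.exp_log hb0]]
    rw [← Real.exp_add, Real.exp_le_exp]
    nlinarith
  -- Since n√n = exp(3x/2), the value 5/2 leaves exp(-x), which tends to 0.
  have hmain : 5 / 2 * x ≤ b ^ m * (n / m : ℕ) := by
    calc 5 / 2 * x = 5 * x * (κ * x + 1) / (2 * (κ * x + 1)) := by
          have : κ * x + 1 ≠ 0 := by positivity
          field_simp
      _ ≤ b * Real.exp (δ * x) / (2 * (κ * x + 1)) := by gcongr
      _ ≤ b * Real.exp (δ * x) / (2 * m) := by gcongr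
      _ = b * Real.exp (-(ℓ * κ * x)) * (n / (2 * m)) := by
          rw [hnx, show δ * x = -(ℓ * κ * x) + x by rw [hδdef]; ring, Real.exp_add]
          ring
      _ ≤ _ := by gcongr
  have hsq : (n : ℝ) * √n = Real.exp (3 / 2 * x) := by
    rw [hnx, Real.sqrt_eq_rpow, ← Real.exp_mul, ← Real.exp_add]
    ring_nf
  rw [hsq, ← Real.exp_add, Real.exp_le_exp]
  linarith

end Calculus

/-! ### Assembly of the two tails. -/

lemma toReal_apply_one_lt_one {p : PMF ℕ} (h0 : p 0 ≠ 0) : (p 1).toReal < 1 := by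
  have := sum_toReal_le_one p
  have := ENNReal.toReal_pos h0 (p.apply_ne_top 0)
  linarith

lemma setOf_le_abs_sub_subset {Ω : Type*} (L : Ω → ℕ) {x a ε : ℝ} (hx : 0 < x) :
    {ω | ε ≤ |(L ω : ℝ) / x - a|} ⊆
      {ω | ⌈(a + ε) * x⌉₊ ≤ L ω} ∪ {ω | L ω < ⌊(a - ε) * x⌋₊ + 1} := by
  intro ω hω
  rcases le_abs'.mp (Set.mem_ofPred.mp hω) with h | h
  · right
    refine Nat.lt_succ_of_le (Nat.le_floor ?_)
    rw [← div_le_iff₀ hx]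
    linarith
  · left
    refine Nat.ceil_le.mpr ?_
    rw [← le_div_iff₀ hx]
    linarith

end GaltonWatson

open GaltonWatson

theorem lemma10 {Ω : Type*} [MeasurableSpace Ω] (P : Measure Ω) [IsProbabilityMeasure P]
    (p : PMF ℕ)
    (hfin : MemLp (fun i : ℕ => (i : ℝ)) 2 p.toMeasure)
    (hmean : ∫ i : ℕ, (i : ℝ) ∂p.toMeasure = 1)
    (hvar : 0 < variance (fun i : ℕ => (i : ℝ)) p.toMeasure)
    (hp1 : p 1 ≠ 0)
    (ξ : List ℕ → Ω → ℕ) (hξ : GaltonWatson.IsOffspringFamily P p ξ) :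
    (∀ n : ℕ, 1 ≤ n → P {ω | GaltonWatson.size (fun u => ξ u ω) = (n : ℕ∞)} ≠ 0) ∧
    ∀ ε : ℝ, 0 < ε →
      Tendsto
        (fun n : ℕ =>
          (ProbabilityTheory.cond P {ω | GaltonWatson.size (fun u => ξ u ω) = (n : ℕ∞)})
            {ω | ε ≤ |(GaltonWatson.maxLeafHeight (fun u => ξ u ω) : ℝ) / Real.log (n : ℝ)
                      - 1 / Real.log (1 / (p 1).toReal)|})
        atTop (𝓝 0) := by
  have hp0 := apply_zero_ne_zero hfin hmean hvar
  refine ⟨fun n hn => by rw [hξ.measure_size_eq]; exact cardProb_ne_zero hp0 hp1 hn,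
    fun ε hε => ?_⟩
  have hb0 := ENNReal.toReal_pos hp1 (p.apply_ne_top 1)
  have hb1 := toReal_apply_one_lt_one hp0
  obtain ⟨C, hC, hH⟩ := exists_highProb_le_mul_cardProb hp0 hp1 hfin hmean hvar
  obtain ⟨D, hD, hL⟩ := exists_lowProb_le_mul_cardProb hp0 hp1 hfin hmean hvar
  have hlim := ((tendsto_high hb0 hb1 hε).const_mul C).add ((tendsto_low hb0 hb1 hε).const_mul D)
  rw [mul_zero, mul_zero, add_zero] at hlim
  have hlim' := ENNReal.tendsto_ofReal hlim
  rw [ENNReal.ofReal_zero] at hlim'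
  refine tendsto_of_tendsto_of_tendsto_of_le_of_le' tendsto_const_nhds hlim'
    (Eventually.of_forall fun n => zero_le) ?_
  filter_upwards [hH, hL, eventually_ge_atTop 1,
    tendsto_log_natCast.eventually (eventually_gt_atTop 0)] with n hHn hLn hn hlog
  have hq0 := cardProb_ne_zero hp0 hp1 hn
  have hqt : cardProb p n ≠ ⊤ := ((cardProb_le_one p n).trans_lt ENNReal.one_lt_top).ne
  rw [cond_apply (hξ.measurableSet_size_eq n), hξ.measure_size_eq,
    ENNReal.inv_mul_le_iff hq0 hqt]
  set h₁ := ⌈(1 / Real.log (1 / (p 1).toReal) + ε) * Real.log n⌉₊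
  -- The + 1 makes the strict event below `h₂` contain the case of equality with the floor.
  set h₂ := ⌊(1 / Real.log (1 / (p 1).toReal) - ε) * Real.log n⌋₊ + 1
  refine (measure_mono (Set.inter_subset_inter_right _
    (setOf_le_abs_sub_subset _ hlog))).trans ?_
  rw [Set.inter_union_distrib_left]
  refine (measure_union_le _ _).trans ((add_le_add (hξ.measure_le_maxLeafHeight h₁ n)
    (hξ.measure_maxLeafHeight_lt h₂ n)).trans ?_)
  have hHt : highProb p h₁ n ≠ ⊤ := ((highProb_le_one p h₁ n).trans_lt ENNReal.one_lt_top).ne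
  have hLt : lowProb p h₂ n ≠ ⊤ := ((lowProb_le_one p h₂ n).trans_lt ENNReal.one_lt_top).ne
  rw [← ENNReal.ofReal_toReal (ENNReal.add_ne_top.mpr ⟨hHt, hLt⟩), ENNReal.toReal_add hHt hLt]
  nth_rewrite 1 [← ENNReal.ofReal_toReal hqt]
  rw [← ENNReal.ofReal_mul ENNReal.toReal_nonneg]
  refine ENNReal.ofReal_le_ofReal ((add_le_add (hHn h₁) (hLn h₂)).trans_eq ?_)
  ring
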